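/- **Notation.** For $Q,K,V\in\mathbb R^{n\times d}$ let $A=\exp(QK^\top)$ (entrywise), $D=\mathrm{diag}(D_{ii})$ with $D_{ii}=\|A_{i,:}\|_1$; $\|\cdot\|_{op}$ is the Euclidean operator norm. For $M\in\{0,1\}^{n\times n}$ put $u_i(M)=\sum_j(1-M_{ij})A_{ij}$ and $a_i(M)=\sum_j M_{ij}A_{ij}$. **Hamming sorted LSH** with $r$ bits: a random function $\mathcal H:\mathbb R^d\to\{0,\dots,2^r-1\}$ such that for all nonzero $x,y$ with angle $\theta$: $\Pr[\mathcal H(x)=\mathcal H(y)]=(1-\theta/\pi)^r$ and $\Pr[\mathcal H(x)=\mathcal H(y)\pm1 \bmod 2^r]=\frac{2\theta}{\pi}(1-\theta/\pi)^{r-1}$. **sortLSH** with block size $b$: draw $\mathcal H$, let $P_Q,P_K$ be the permutations of $\{0,\dots,n-1\}$ giving the position of each row of $Q$, resp. $K$, when the rows are sorted by hash value, and return $M_{ij}=1$ if $\lfloor P_Q(i)/b\rfloor=\lfloor P_K(j)/b\rfloor$, and $M_{ij}=0$ otherwise. **HyperAttention**$(Q,K,V,M;\kappa,\varepsilon,m_1,m_2)$,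 with a constant $c>0$: choose $T\subseteq[n]$ uniformly with $|T|=\min(m_1,n)$ and set $\tau=\max_{j\in T}u_j(M)$; draw $\ell_1,\dots,\ell_{m_1}$ i.i.d. uniform in $[n]$; for each $i$ set $$C_i=c\,\frac{\varepsilon^2m_1}{n\log n}\Big(a_i(M)+\frac\tau\kappa\Big),\quad d_i=\frac n{m_1}\sum_{j\le m_1}(1-M_{i\ell_j})\min(A_{i\ell_j},C_i),\quad \tilde d_i=a_i(M)+\max\Big(d_i,\frac\tau\kappa\Big),$$ and $\widetilde D=\mathrm{diag}(\tilde d_i)$. Independently, draw $\ell'_1,\dots,\ell'_{m_2}$ i.i.d. with probabilities $\|V_{i,:}\|_2^2/\|V\|_F^2$ (uniform if $V=0$) and let row $p$ of $S\in\mathbb R^{m_2\times n}$ be $\frac{\|V\|_F}{\sqrt{m_2}\,\|V_{\ell'_p,:}\|_2}\,e^{(\ell'_p)}$. Return $\widetilde D,S$. Running time counts elementary steps on a machine with unit-cost real arithmetic (including $\exp$, $\log$, square root) and comparisons. The mask is stored by its rows' lists of nonzero positions. Sorting $n$ keys costs $O(n\log n)$, a uniform random index costs one step, and a uniform subset of $[n]$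 or one sample from explicit weights on $[n]$ costs $O(n)$. **Corollary (HyperAttention with sortLSH).** Let $\delta:\mathbb N\to\mathbb R$ with $\delta(n)\to0$ and let $c>0$. There is $\delta_0(n)\to0$ such that for every $\delta_1(n)\to0$ there are $\delta_2(n)\to0$ and $N$ such that the following holds for all $n\ge N$, $d\ge1$, $Q,K,V\in\mathbb R^{n\times d}$, every Hamming sorted LSH on $\mathbb R^d$ with $r=\lfloor\log_2n\rfloor$ or $r=\lceil\log_2 n\rceil$ bits which can be drawn, and evaluated at one point, in at most $d\,n^{\delta(n)}$ steps, every integer block size $1\le b\le n^{\delta(n)}$, every $\varepsilon>1/n^{\delta(n)}$ and every $0<\kappa\le n^{\delta(n)}$. Suppose that $\|D^{-1}Ae^{(j)}\|_2^2\le n^{\delta(n)}/n$ for all $j$, and that at most $n^{1+\delta(n)}$ pairs $(i,j)$ have $\theta(Q_{i,:},K_{j,:})\le\frac\pi2(1-\delta(n))$. Let $M$ be the mask returned by sortLSH. 1. With probability at least $1-1/n^{\delta(n)}$, $M$ has at most $n^{1+\delta_2(n)}$ nonzero entries. 2. Let $m_1\ge n^{\delta_0(n)}$ and $m_2\ge d\,n^{\delta_0(n)}$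 be integers. Conditionally on any hash function whose mask satisfies $\max_iu_i(M)\le\kappa\min_ju_j(M)$, with probability at least $0.98$ the output of HyperAttention$(Q,K,V,M;\kappa,\varepsilon,m_1,m_2)$ satisfies that $\widetilde D$ has positive diagonal and $$\|D^{-1}AV-\widetilde D^{-1}AS^\top SV\|_{op}\le\varepsilon\,\|D^{-1}A\|_{op}\,\|V\|_{op}.$$ Consequently, if $\max_iu_i(M)\le\kappa\min_ju_j(M)$ holds almost surely, this guarantee holds with probability at least $0.98$ over all the randomness, including that of the hash function. 3. If moreover $m_1\le n^{\delta_1(n)}$ and $m_2\le d\,n^{\delta_1(n)}$, then the whole algorithm (sortLSH followed by HyperAttention) always takes at most $d\,n^{1+\delta_2(n)}$ steps. -/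

import Mathlib

open Filter Topology MeasureTheory

noncomputable section

/-! ### A real-arithmetic machine with step counting

A deterministic computation is its result together with the number of elementary steps it takes.
Elementary steps (one each): an arithmetic operation, square root, exponential, logarithm or
comparison on reals or indices, and one memory access that stores a result. -/

/-- The result of a computation and its number of steps. -/
structure Timed (α : Type) where
  val : α
  steps : ℕ

namespace Timed

/-- Sequential composition adds up the steps. -/
instance : Monad Timed where
  pure a := ⟨a, 0⟩
  bind x f := ⟨(f x.val).val, x.steps + (f x.val).steps⟩

/-- A value obtained from already computed ones by `k` elementary operations. -/
def op {α : Type} (k : ℕ) (a : α) : Timed α := ⟨a, k⟩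

/-- Fill an array of length `n`; one step per stored entry. -/
def array {α : Type} {n : ℕ} (f : Fin n → Timed α) : Timed (Fin n → α) :=
  ⟨fun i => (f i).val, ∑ i, ((f i).steps + 1)⟩

/-- Accumulate a sum over the entries of a list of distinct items; one addition per item. -/
def sum {ι : Type} (s : Finset ι) (f : ι → Timed ℝ) : Timed ℝ :=
  ⟨∑ i ∈ s, (f i).val, ∑ i ∈ s, ((f i).steps + 1)⟩

/-- Running maximum (started at `0`) over a list of distinct items; one comparison per item. -/
def max {ι : Type} (s : Finset ι) (f : ι → Timed ℝ) : Timed ℝ :=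
  ⟨s.fold Max.max 0 (fun i => (f i).val), ∑ i ∈ s, ((f i).steps + 1)⟩

/-- Membership test by a scan through the list. -/
def mem {ι : Type} [DecidableEq ι] (i : ι) (s : Finset ι) : Timed Bool :=
  ⟨decide (i ∈ s), s.card + 1⟩

/-- Inner product of two vectors of length `d`. -/
def dot {d : ℕ} (x y : Fin d → ℝ) : Timed ℝ :=
  sum Finset.univ fun k => op 1 (x k * y k)

/-- Merge sort of `n` keys: `n ⌈log₂ n⌉` comparisons and as many moves (plus linear overhead).
The result lists the items in sorted order: item `σ p` is at position `p`, and `h ∘ σ` is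
monotone. -/
def sort {n N : ℕ} (h : Fin n → Fin N) : Timed (Equiv.Perm (Fin n)) :=
  ⟨Tuple.sort h, 2 * n * (Nat.clog 2 n + 1)⟩

end Timed

/-- A randomized algorithm: the joint law of its result and of its number of steps. -/
def Alg (α : Type) : Type := PMF (Timed α)

namespace Alg

/-- The law of result and step count. -/
def law {α : Type} (p : Alg α) : PMF (Timed α) := p

instance : Monad Alg where
  pure a := PMF.pure ⟨a, 0⟩
  bind p f := PMF.bind p.law fun x =>
    PMF.map (fun y : Timed _ => ⟨y.val, x.steps + y.steps⟩) (f x.val).law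

/-- Run a deterministic computation. -/
def run {α : Type} (t : Timed α) : Alg α := PMF.pure t

/-- Draw a random element with law `p`, charged `k` steps. -/
def draw {α : Type} (k : ℕ) (p : PMF α) : Alg α := PMF.map (fun a => (⟨a, k⟩ : Timed α)) p

/-- The probability that the result of the algorithm satisfies `E`. -/
def prob {α : Type} (p : Alg α) (E : α → Prop) : ENNReal :=
  p.law.toOuterMeasure {o | E o.val}

/-- Every run of the algorithm takes at most `T` steps. -/
def RunsWithin {α : Type} (p : Alg α) (T : ℝ) : Prop :=
  ∀ o ∈ p.law.support, (o.steps : ℝ) ≤ T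

end Alg

/-- The law of `m` independent samples from `p`. -/
def iid {α : Type} [Fintype α] (m : ℕ) (p : PMF α) : PMF (Fin m → α) :=
  PMF.ofFintype (fun l => ∏ j, p (l j)) (by
    classical
    have h := Fintype.piFinset_univ (α := Fin m) (β := fun _ => α)
    rw [← h, ← Finset.prod_univ_sum]
    have h1 : ∑ a, p a = 1 := by rw [← tsum_fintype (L := .unconditional _)]; exact p.tsum_coe
    simp [h1])

/-- The law on `[n]` proportional to the nonnegative weights `w` (uniform if all weights vanish). -/
def categorical {n : ℕ} [NeZero n] (w : Fin n → ℝ) : PMF (Fin n) := by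
  classical
  exact
    if h : ∑' i, ENNReal.ofReal (w i) = 0 then PMF.uniformOfFintype (Fin n)
    else PMF.normalize (fun i => ENNReal.ofReal (w i)) h (by
      rw [tsum_fintype]; exact ENNReal.sum_ne_top.2 fun _ _ => ENNReal.ofReal_ne_top)

/-- A uniformly random subset of `[n]` of cardinality `m` (all of `[n]` if `m > n`). -/
def uniformSubset (n m : ℕ) : PMF (Finset (Fin n)) :=
  PMF.uniformOfFinset (Finset.powersetCard (min m n) Finset.univ)
    (Finset.powersetCard_nonempty.2 (by simp))

/-! ### Attention -/

/-- The operator norm with respect to the Euclidean norms. -/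
def opNorm {m n : ℕ} (A : Matrix (Fin m) (Fin n) ℝ) : ℝ :=
  ‖(Matrix.toEuclideanLin A).toContinuousLinearMap‖

/-- The attention matrix `A = exp(Q Kᵀ)` (entrywise exponential). -/
def attnMatrix {n d : ℕ} (Q K : Matrix (Fin n) (Fin d) ℝ) : Matrix (Fin n) (Fin n) ℝ :=
  (Q * K.transpose).map Real.exp

/-- The diagonal entries `D i = ‖A i‖₁` of the scaling matrix `D`. -/
def attnDiag {n d : ℕ} (Q K : Matrix (Fin n) (Fin d) ℝ) (i : Fin n) : ℝ :=
  ∑ j, |attnMatrix Q K i j|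

/-- The softmax matrix `D⁻¹ A`. -/
def softmaxMatrix {n d : ℕ} (Q K : Matrix (Fin n) (Fin d) ℝ) : Matrix (Fin n) (Fin n) ℝ :=
  Matrix.diagonal (fun i => (attnDiag Q K i)⁻¹) * attnMatrix Q K

/-- The angle `arccos (⟨x, y⟩ / (‖x‖ ‖y‖))` of two vectors of Euclidean space. -/
def vecAngle {d : ℕ} (x y : Fin d → ℝ) : ℝ :=
  InnerProductGeometry.angle (WithLp.toLp 2 x) (WithLp.toLp 2 y)

/-- A mask, stored as the list of the positions of the ones of each row. -/
abbrev SparseMask (n : ℕ) : Type := Fin n → Finset (Fin n)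

/-- The `{0,1}`-matrix of a mask. -/
def SparseMask.toMatrix {n : ℕ} (M : SparseMask n) : Matrix (Fin n) (Fin n) ℝ :=
  fun i j => if j ∈ M i then 1 else 0

/-- The number of nonzero entries. -/
def nnz {n : ℕ} (M : Matrix (Fin n) (Fin n) ℝ) : ℕ :=
  Set.ncard {p : Fin n × Fin n | M p.1 p.2 ≠ 0}

/-- The unmasked row sum `⟨1 - M i, A i⟩`. -/
def unmaskedRowSum {n : ℕ} (M A : Matrix (Fin n) (Fin n) ℝ) (i : Fin n) : ℝ :=
  ∑ j, (1 - M i j) * A i j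

/-- The ratio of the largest to the smallest unmasked row sum is at most `κ`. -/
def CondNumberLE {n : ℕ} (M A : Matrix (Fin n) (Fin n) ℝ) (κ : ℝ) : Prop :=
  ∀ i j, unmaskedRowSum M A i ≤ κ * unmaskedRowSum M A j

/-! ### Hamming sorted LSH and sortLSH -/

/-- A Hamming sorted LSH: a random hash function from `ℝᵈ` to `2 ^ r` cyclically ordered buckets
with the prescribed probabilities for two nonzero vectors to land in the same bucket and in
adjacent buckets. The hash function is determined by a random seed; drawing the seed takes
`drawSteps` steps, and a hash value is computed from the seed with an explicit number of steps. -/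
structure HammingSortedLSH (d r : ℕ) where
  Seed : Type
  [measurableSpace : MeasurableSpace Seed]
  law : Measure Seed
  [isProbabilityMeasure : IsProbabilityMeasure law]
  drawSteps : ℕ
  hash : Seed → (Fin d → ℝ) → Timed (Fin (2 ^ r))
  measurable_hash : ∀ x, Measurable fun s => (hash s x).val
  collision : ∀ x y : Fin d → ℝ, x ≠ 0 → y ≠ 0 →
    law.real {s | (hash s x).val = (hash s y).val} = (1 - vecAngle x y / Real.pi) ^ r
  adjacent : ∀ x y : Fin d → ℝ, x ≠ 0 → y ≠ 0 →
    law.real {s | ((hash s x).val : ℕ) ≡ ((hash s y).val : ℕ) + 1 [MOD 2 ^ r] ∨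
        ((hash s y).val : ℕ) ≡ ((hash s x).val : ℕ) + 1 [MOD 2 ^ r]} =
      2 * vecAngle x y / Real.pi * (1 - vecAngle x y / Real.pi) ^ (r - 1)

attribute [instance] HammingSortedLSH.measurableSpace HammingSortedLSH.isProbabilityMeasure

/-- sortLSH with block size `b`, for the hash function with seed `s`. Here `σQ`, `σK` list the
queries and keys in the order of their buckets, so their inverses are the permutations `P_Q`,
`P_K`, and `M i j = 1` iff `⌊P_Q i / b⌋ = ⌊P_K j / b⌋`. Row `i` of the mask is read off from the
at most `b` consecutive entries of the sorted list of keys that form the block of `i`. -/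
def sortLSH {n d r : ℕ} (H : HammingSortedLSH d r) (s : H.Seed)
    (Q K : Matrix (Fin n) (Fin d) ℝ) (b : ℕ) : Timed (SparseMask n) := do
  Timed.op H.drawSteps ()
  let hQ ← Timed.array fun i => H.hash s (Q i)
  let hK ← Timed.array fun i => H.hash s (K i)
  let σQ ← Timed.sort hQ
  let σK ← Timed.sort hK
  let PQ ← Timed.op n σQ.symm
  let PK ← Timed.op n σK.symm
  Timed.array fun i =>
    Timed.op (2 * b + 2) (Finset.univ.filter fun j => (PQ i : ℕ) / b = (PK j : ℕ) / b)

/-! ### ApproxD and HyperAttention -/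

/-- The entry `exp ⟨Q i, K j⟩`. -/
def attnEntry {n d : ℕ} (Q K : Matrix (Fin n) (Fin d) ℝ) (i j : Fin n) : Timed ℝ := do
  let z ← Timed.dot (Q i) (K j)
  Timed.op 1 (Real.exp z)

/-- `t` at the unmasked position `(i, j)`, and `0` at a masked one. -/
def ifUnmasked {n : ℕ} (M : SparseMask n) (i j : Fin n) (t : Timed ℝ) : Timed ℝ := do
  let masked ← Timed.mem j (M i)
  if masked then Timed.op 1 0 else t

/-- ApproxD: estimates of the diagonal entries of `D` from `m` sampled rows and columns. The
hidden constant in the definition of the cap `C i` is `c`. -/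
def approxD {n d : ℕ} [NeZero n] (Q K : Matrix (Fin n) (Fin d) ℝ) (M : SparseMask n)
    (κ ε c : ℝ) (m : ℕ) : Alg (Fin n → ℝ) := do
  let T ← Alg.draw n (uniformSubset n m)
  let τ ← Alg.run (Timed.max T fun j =>
    Timed.sum Finset.univ fun k => ifUnmasked M j k (attnEntry Q K j k))
  let l ← Alg.draw m (iid m (PMF.uniformOfFintype (Fin n)))
  Alg.run (Timed.array fun i => do
    let a ← Timed.sum (M i) fun k => attnEntry Q K i k
    let C ← Timed.op 10 (c * (ε ^ 2 * m / (n * Real.log n) * (a + τ / κ)))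
    let u ← Timed.sum Finset.univ fun j : Fin m => ifUnmasked M i (l j) (do
      let e ← attnEntry Q K i (l j)
      Timed.op 1 (min e C))
    let t ← Timed.op 2 ((n : ℝ) / m * u)
    Timed.op 3 (a + Max.max t (τ / κ)))

/-- Row `p` of the sampling matrix `S` is `scale p` times the unit vector `e (idx p)`. -/
structure Sampling (n m : ℕ) where
  idx : Fin m → Fin n
  scale : Fin m → ℝ

/-- The sampling matrix `S`. -/
def Sampling.toMatrix {n m : ℕ} (S : Sampling n m) : Matrix (Fin m) (Fin n) ℝ :=
  fun p i => if i = S.idx p then S.scale p else 0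

/-- `m` independent samples according to the squared row norms of `V`, the sampled rows being
scaled by `‖V‖_F / (√m ‖V (idx p)‖)`. One sample costs a pass through the `n` weights. -/
def rowNormSampling {n d : ℕ} [NeZero n] (V : Matrix (Fin n) (Fin d) ℝ) (m : ℕ) :
    Alg (Sampling n m) := do
  let w ← Alg.run (Timed.array fun i => Timed.dot (V i) (V i))
  let F ← Alg.run (Timed.sum Finset.univ fun i => Timed.op 0 (w i))
  let l ← Alg.draw (m * (2 * n)) (iid m (categorical w))
  let sc ← Alg.run (Timed.array fun p =>
    Timed.op 5 (Real.sqrt F / (Real.sqrt m * Real.sqrt (w (l p)))))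
  pure ⟨l, sc⟩

/-- HyperAttention for a given mask, with sample size `m₁` in ApproxD and a sampling matrix with
`m₂` rows. The result is the diagonal of `D̃` and the sampling matrix. -/
def hyperAttention {n d : ℕ} [NeZero n] (Q K V : Matrix (Fin n) (Fin d) ℝ) (M : SparseMask n)
    (κ ε c : ℝ) (m₁ m₂ : ℕ) : Alg ((Fin n → ℝ) × Sampling n m₂) := do
  let D ← approxD Q K M κ ε c m₁
  let S ← rowNormSampling V m₂
  pure (D, S)

/-- HyperAttention with the mask computed by sortLSH from the hash function with seed `s`. -/
def hyperAttentionLSH {n d r : ℕ} [NeZero n] (H : HammingSortedLSH d r) (s : H.Seed)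
    (Q K V : Matrix (Fin n) (Fin d) ℝ) (b : ℕ) (κ ε c : ℝ) (m₁ m₂ : ℕ) :
    Alg ((Fin n → ℝ) × Sampling n m₂) := do
  let M ← Alg.run (sortLSH H s Q K b)
  hyperAttention Q K V M κ ε c m₁ m₂

/-- The matrix of the mask that sortLSH finds. -/
def lshMask {n d r : ℕ} (H : HammingSortedLSH d r) (s : H.Seed)
    (Q K : Matrix (Fin n) (Fin d) ℝ) (b : ℕ) : Matrix (Fin n) (Fin n) ℝ :=
  (sortLSH H s Q K b).val.toMatrix

/-- The spectral guarantee
`‖D⁻¹ A V - D̃⁻¹ A Sᵀ S V‖ ≤ ε ‖D⁻¹ A‖ ‖V‖`, with an invertible (positive) `D̃`. -/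
def SpectralGuarantee {n d m : ℕ} (Q K V : Matrix (Fin n) (Fin d) ℝ) (ε : ℝ)
    (o : (Fin n → ℝ) × Sampling n m) : Prop :=
  (∀ i, 0 < o.1 i) ∧
  opNorm (softmaxMatrix Q K * V -
      Matrix.diagonal (fun i => (o.1 i)⁻¹) * attnMatrix Q K *
        o.2.toMatrix.transpose * (o.2.toMatrix * V)) ≤
    ε * opNorm (softmaxMatrix Q K) * opNorm V

end

/-! Write `P = D⁻¹A`, `E = D / D̃` and `w = n^{δ n}`. The error splits as `PV - E P SᵀS V = (1 - E)
P V + E (PV - P SᵀS V)`, and the two summands come from the two sampling stages. Since `P` fixes the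
all-ones vector, `‖P‖ ≥ 1`, so it suffices that each summand has norm at most `(ε/2) ‖V‖`.

Diagonal error. The condition on `κ` places every unmasked row sum `u i` between `τ/κ` and `κτ`,
whatever nonempty set `T` was drawn. Hence the floor `τ/κ` in `D̃` never hurts, and `D ≤ w² D̃`
holds surely. The capped estimate of `u i` has variance at most `(n/m₁) ∑ⱼ A i j²` and squared bias
at most `(D i / C i) ∑ⱼ A i j²`; the choice of `C i` makes both comparable up to powers of `w` and
`log n`. Therefore `∑ᵢ (1 - E i)²` has mean at most `(n/m₁) n^{o(1)}`
(`mean_sum_sq_relative_error_le`). A weighted Cauchy–Schwarz bound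
(`opNorm_sq_diagonal_mul_le_sqrt`) controls `‖(1 - E) P‖²` by `max |1 - E|` times the square root of
that sum times the largest squared column norm of `P`. The column norm is at most `w/n`, which
cancels the factor `n`, so `m₁ = n^{o(1)}` samples suffice.

Product error. Row norm sampling has mean squared Frobenius error at most `‖P‖_F² ‖V‖_F² / m₂ ≤ w d
‖V‖² / m₂` (`rowNormSampling_prob_ge`), and `‖E‖ ≤ w²`.

Markov's inequality gives each stage probability `0.99`, and `0.99² ≥ 0.98`. Sparsity and running
time are deterministic: a block contains at most `b` keys, so each mask row has at most `b` ones.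
Constants and logarithms are absorbed into the exponents `δ₀` and `δ₂`. -/

/-! ### Step counts of deterministic computations. -/

namespace Timed

variable {α β : Type}

@[simp] theorem val_bind (x : Timed α) (f : α → Timed β) : (x >>= f).val = (f x.val).val := rfl

@[simp] theorem steps_bind (x : Timed α) (f : α → Timed β) :
    (x >>= f).steps = x.steps + (f x.val).steps := rfl

@[simp] theorem val_op (k : ℕ) (a : α) : (op k a).val = a := rfl

@[simp] theorem steps_op (k : ℕ) (a : α) : (op k a).steps = k := rfl

theorem steps_dot {d : ℕ} (x y : Fin d → ℝ) : (dot x y).steps = 2 * d := by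
  simp [dot, sum, op, mul_comm]

theorem steps_sum_le {ι : Type} (s : Finset ι) (f : ι → Timed ℝ) (k : ℕ)
    (h : ∀ i ∈ s, (f i).steps ≤ k) : (sum s f).steps ≤ s.card * (k + 1) := by
  exact (Finset.sum_le_card_nsmul s (fun i => (f i).steps + 1) (k + 1)
    fun i hi => Nat.succ_le_succ (h i hi)).trans_eq (smul_eq_mul _ _)

theorem steps_max_le {ι : Type} (s : Finset ι) (f : ι → Timed ℝ) (k : ℕ)
    (h : ∀ i ∈ s, (f i).steps ≤ k) : (max s f).steps ≤ s.card * (k + 1) :=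
  steps_sum_le s f k h

theorem steps_array_le {n : ℕ} (f : Fin n → Timed α) (k : ℕ)
    (h : ∀ i, (f i).steps ≤ k) : (array f).steps ≤ n * (k + 1) := by
  exact (Finset.sum_le_card_nsmul Finset.univ (fun i => (f i).steps + 1) (k + 1)
    fun i _ => Nat.succ_le_succ (h i)).trans_eq (by simp)

end Timed

/-! ### Success probabilities and step bounds of randomized algorithms. -/

namespace Alg

variable {α β : Type}

theorem law_bind (p : Alg α) (f : α → Alg β) : (p >>= f).law = p.law.bind fun x =>
    PMF.map (fun y : Timed β => ⟨y.val, x.steps + y.steps⟩) (f x.val).law := rfl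

theorem prob_bind (p : Alg α) (f : α → Alg β) (E : β → Prop) :
    (p >>= f).prob E = ∑' x, p.law x * (f x.val).prob E := by
  unfold prob
  rw [law_bind, PMF.toOuterMeasure_bind_apply]
  simp only [PMF.toOuterMeasure_map_apply]
  rfl

/-- The chain rule for conditional probabilities as a lower bound: `G` is the good event of the
first stage, and outcomes outside `G` are discarded. -/
theorem mul_le_prob_bind (p : Alg α) (f : α → Alg β) (G : α → Prop) (E : β → Prop)
    {a b : ENNReal} (ha : a ≤ p.prob G) (hb : ∀ x, G x → b ≤ (f x).prob E) :
    a * b ≤ (p >>= f).prob E := by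
  rw [prob_bind]
  refine (mul_le_mul_left ha b).trans ?_
  rw [prob, PMF.toOuterMeasure_apply, ← ENNReal.tsum_mul_right]
  refine ENNReal.tsum_le_tsum fun x => ?_
  by_cases hx : G x.val
  · rw [Set.indicator_of_mem (by exact hx)]
    exact mul_le_mul_right (hb _ hx) _
  · rw [Set.indicator_of_notMem (by exact hx)]
    simp

theorem prob_run_bind (t : Timed α) (f : α → Alg β) (E : β → Prop) :
    (run t >>= f).prob E = (f t.val).prob E := by
  have h : (run t >>= f).law = PMF.map (fun y : Timed β => ⟨y.val, t.steps + y.steps⟩)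
      (f t.val).law := PMF.pure_bind _ _
  rw [prob, h, PMF.toOuterMeasure_map_apply]
  rfl

theorem prob_pure (a : α) (E : α → Prop) (h : E a) : (pure a : Alg α).prob E = 1 := by
  change (PMF.pure (⟨a, 0⟩ : Timed α)).toOuterMeasure _ = 1
  rw [PMF.toOuterMeasure_pure_apply, if_pos]
  exact h

theorem prob_run (t : Timed α) (E : α → Prop) (h : E t.val) : (run t).prob E = 1 := by
  change (PMF.pure t).toOuterMeasure _ = 1
  rw [PMF.toOuterMeasure_pure_apply, if_pos]
  exact h

theorem prob_draw (k : ℕ) (p : PMF α) (E : α → Prop) :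
    (draw k p).prob E = p.toOuterMeasure {a | E a} := by
  unfold prob draw law
  rw [PMF.toOuterMeasure_map_apply]
  rfl

/-- The restriction to the support matters: the cost of computing `τ` depends on the cardinality of
`T`, which is known only for sets that can be drawn. -/
theorem runsWithin_bind {p : Alg α} {f : α → Alg β} {S T : ℝ} (hp : p.RunsWithin S)
    (hf : ∀ o ∈ p.law.support, (f o.val).RunsWithin T) : (p >>= f).RunsWithin (S + T) := by
  intro o ho
  rw [law_bind, PMF.mem_support_bind_iff] at ho
  obtain ⟨x, hx, ho⟩ := ho
  rw [PMF.mem_support_map_iff] at ho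
  obtain ⟨y, hy, rfl⟩ := ho
  have h1 := hp x hx
  have h2 := hf x hx y hy
  push_cast
  linarith

theorem runsWithin_run {t : Timed α} {T : ℝ} (h : (t.steps : ℝ) ≤ T) : (run t).RunsWithin T := by
  intro o ho
  have : o = t := by simpa [run, law] using ho
  rwa [this]

theorem runsWithin_pure (a : α) : (pure a : Alg α).RunsWithin 0 := by
  intro o ho
  have : o = ⟨a, 0⟩ := (PMF.mem_support_pure_iff _ _).1 ho
  simp [this]

theorem mem_support_draw {k : ℕ} {p : PMF α} {o : Timed α} (h : o ∈ (draw k p).law.support) :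
    o.val ∈ p.support ∧ o.steps = k := by
  obtain ⟨a, ha, rfl⟩ := (PMF.mem_support_map_iff _ _ _).1 h
  exact ⟨ha, rfl⟩

theorem runsWithin_draw (k : ℕ) (p : PMF α) : (draw k p).RunsWithin k := by
  intro o ho
  rw [(mem_support_draw ho).2]

theorem mem_support_run {t o : Timed α} (h : o ∈ (run t).law.support) : o = t := by
  simpa [run, law] using h

end Alg

/-! ### Expectations, Markov's inequality and second moments of independent samples. -/

/-- The expectation of a real function on a finite type. -/
noncomputable def PMF.mean {α : Type} [Fintype α] (p : PMF α) (f : α → ℝ) : ℝ :=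
  ∑ a, (p a).toReal * f a

namespace PMF

variable {α : Type} [Fintype α] (p : PMF α)

theorem mean_const (c : ℝ) : p.mean (fun _ => c) = c := by
  have h : ∑ a, (p a).toReal = 1 := by
    rw [← ENNReal.toReal_sum fun a _ => p.apply_ne_top a, ← tsum_fintype (L := .unconditional _),
      p.tsum_coe, ENNReal.toReal_one]
  rw [mean, ← Finset.sum_mul, h, one_mul]

theorem mean_sum {ι : Type*} (s : Finset ι) (f : ι → α → ℝ) :
    p.mean (fun a => ∑ i ∈ s, f i a) = ∑ i ∈ s, p.mean (f i) := by
  simp only [mean, Finset.mul_sum]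
  exact Finset.sum_comm

theorem mean_add (f g : α → ℝ) : p.mean (fun a => f a + g a) = p.mean f + p.mean g := by
  simp only [mean, mul_add, Finset.sum_add_distrib]

theorem mean_const_mul (c : ℝ) (f : α → ℝ) : p.mean (fun a => c * f a) = c * p.mean f := by
  simp only [mean, Finset.mul_sum]
  exact Finset.sum_congr rfl fun a _ => by ring

theorem mean_mono {f g : α → ℝ} (h : ∀ a, f a ≤ g a) : p.mean f ≤ p.mean g :=
  Finset.sum_le_sum fun a _ => mul_le_mul_of_nonneg_left (h a) ENNReal.toReal_nonneg

/-- Markov's inequality in the form that a nonnegative function is at most `100` times its mean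
with probability `99 / 100`. -/
theorem le_toOuterMeasure_of_mean_le (f : α → ℝ) (hf : ∀ a, 0 ≤ f a) (t : ℝ)
    (h : 100 * p.mean f ≤ t) : 99 / 100 ≤ p.toOuterMeasure {a | f a ≤ t} := by
  classical
  have hsum : ∑ a, (p a).toReal = 1 := by simpa [mean] using p.mean_const 1
  have key : 99 / 100 ≤ ∑ a, if f a ≤ t then (p a).toReal else 0 := by
    by_contra hlt
    push Not at hlt
    have hsplit : ∑ a, (if f a ≤ t then (p a).toReal else 0) +
        ∑ a, (if f a ≤ t then 0 else (p a).toReal) = 1 := by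
      rw [← hsum, ← Finset.sum_add_distrib]
      exact Finset.sum_congr rfl fun a _ => by split_ifs <;> simp
    have hq : 1 / 100 < ∑ a, (if f a ≤ t then 0 else (p a).toReal) := by linarith
    -- Strictness is needed because `t` may be `0`. It comes from an outcome of positive mass in the
    -- tail `f > t`. Then `t/100 ≤ t · (tail mass) < mean ≤ t/100` is absurd.
    have hm : ∑ a, (if f a ≤ t then 0 else (p a).toReal) * t < p.mean f := by
      have hle : ∀ a ∈ Finset.univ, (if f a ≤ t then 0 else (p a).toReal) * t ≤
          (p a).toReal * f a := fun a _ => by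
        split_ifs with ha
        · simpa using mul_nonneg ENNReal.toReal_nonneg (hf a)
        · exact mul_le_mul_of_nonneg_left (not_le.1 ha).le ENNReal.toReal_nonneg
      obtain ⟨a, -, ha⟩ := Finset.exists_lt_of_sum_lt
        (f := fun _ : α => (0 : ℝ)) (s := Finset.univ)
        (g := fun a => if f a ≤ t then 0 else (p a).toReal) (by simp; linarith)
      refine Finset.sum_lt_sum hle ⟨a, Finset.mem_univ _, ?_⟩
      by_cases hat : f a ≤ t
      · simp [hat] at ha
      · simp only [hat, if_false] at ha ⊢
        exact mul_lt_mul_of_pos_left (not_le.1 hat) ha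
    rw [← Finset.sum_mul] at hm
    have ht : 0 ≤ t := by
      have : 0 ≤ p.mean f := Finset.sum_nonneg fun a _ => mul_nonneg ENNReal.toReal_nonneg (hf a)
      linarith
    nlinarith [mul_le_mul_of_nonneg_right hq.le ht]
  rw [toOuterMeasure_apply_fintype]
  have h2 : ∑ a, Set.indicator {a | f a ≤ t} p a =
      ENNReal.ofReal (∑ a, if f a ≤ t then (p a).toReal else 0) := by
    rw [ENNReal.ofReal_sum_of_nonneg fun a _ => by split_ifs <;> simp]
    refine Finset.sum_congr rfl fun a _ => ?_
    by_cases ha : f a ≤ t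
    · simp [Set.indicator, ha, ENNReal.ofReal_toReal (p.apply_ne_top a)]
    · simp [Set.indicator, ha]
  rw [h2]
  refine le_trans (le_of_eq ?_) (ENNReal.ofReal_le_ofReal key)
  rw [ENNReal.ofReal_div_of_pos (by norm_num)]
  norm_num

variable {p}

/-- The factors may differ with `j`, so taking them equal to `1` outside one or two indices yields
the marginals and the pair correlations. -/
theorem mean_iid_prod (m : ℕ) (g : Fin m → α → ℝ) :
    (iid m p).mean (fun l => ∏ j, g j (l j)) = ∏ j, p.mean (g j) := by
  classical
  unfold mean
  rw [Finset.prod_univ_sum, Fintype.piFinset_univ]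
  refine Finset.sum_congr rfl fun l _ => ?_
  rw [Finset.prod_mul_distrib, iid, PMF.ofFintype_apply, ENNReal.toReal_prod]

/-- Expanding the square, the off-diagonal terms vanish by independence and centring. -/
theorem mean_iid_sq_sum {m : ℕ} {h : α → ℝ} (h0 : p.mean h = 0) :
    (iid m p).mean (fun l => (∑ j, h (l j)) ^ 2) = m * p.mean (fun a => h a ^ 2) := by
  classical
  have e : ∀ l : Fin m → α, (∑ j, h (l j)) ^ 2 = ∑ j, ∑ k, h (l j) * h (l k) := fun l => by
    rw [sq, Finset.sum_mul_sum]
  simp only [e, mean_sum]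
  have hjk : ∀ j k : Fin m, (iid m p).mean (fun l => h (l j) * h (l k)) =
      if j = k then p.mean (fun a => h a ^ 2) else 0 := by
    intro j k
    split_ifs with hj
    · subst hj
      have := mean_iid_prod (p := p) m fun i a => if i = j then h a ^ 2 else 1
      simp only [Finset.prod_ite_eq', Finset.mem_univ, if_true] at this
      simp only [← sq]
      rw [this]
      refine (Finset.prod_eq_single j (fun i _ hi => ?_) (by simp)).trans (by simp)
      simpa [hi] using p.mean_const 1
    · have := mean_iid_prod (p := p) m fun i a =>
        (if i = j then h a else 1) * (if i = k then h a else 1)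
      simp only [Finset.prod_mul_distrib, Finset.prod_ite_eq', Finset.mem_univ, if_true] at this
      rw [this]
      refine Finset.prod_eq_zero (Finset.mem_univ j) ?_
      simpa [hj] using h0
  simp [hjk]

/-- The mean square error of an empirical average. -/
theorem mean_iid_sq_sub_le {m : ℕ} (hm : 0 < m) (f : α → ℝ) :
    (iid m p).mean (fun l => ((∑ j, f (l j)) / m - p.mean f) ^ 2) ≤
      p.mean (fun a => f a ^ 2) / m := by
  have hm' : (0 : ℝ) < m := by exact_mod_cast hm
  set μ := p.mean f with hμ
  have h0 : p.mean (fun a => f a + -μ) = 0 := by rw [mean_add, mean_const, ← hμ]; ring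
  have e : ∀ l : Fin m → α, ((∑ j, f (l j)) / m - μ) ^ 2 =
      ((m : ℝ) ^ 2)⁻¹ * (∑ j, (f (l j) + -μ)) ^ 2 := fun l => by
    rw [Finset.sum_add_distrib]
    simp only [Finset.sum_const, Finset.card_univ, Fintype.card_fin, nsmul_eq_mul]
    field_simp
    ring
  simp only [e]
  rw [mean_const_mul, mean_iid_sq_sum h0]
  -- Variance is at most the second moment; the difference is `μ²`.
  have h2 : p.mean (fun a => (f a + -μ) ^ 2) ≤ p.mean (fun a => f a ^ 2) := by
    have : (fun a => (f a + -μ) ^ 2) = fun a => (f a ^ 2 + (-2 * μ) * f a) + μ ^ 2 := by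
      funext a; ring
    rw [this, mean_add, mean_add, mean_const, mean_const_mul, ← hμ]
    nlinarith [sq_nonneg μ]
  calc ((m : ℝ) ^ 2)⁻¹ * (m * p.mean (fun a => (f a + -μ) ^ 2))
      = p.mean (fun a => (f a + -μ) ^ 2) / m := by field_simp
    _ ≤ _ := by gcongr

end PMF

/-! ### Operator norm bounds. -/

section OpNorm

variable {l m n : ℕ}

section

open scoped Matrix.Norms.L2Operator

theorem opNorm_nonneg (A : Matrix (Fin m) (Fin n) ℝ) : 0 ≤ opNorm A := norm_nonneg _

theorem opNorm_add_le (A B : Matrix (Fin m) (Fin n) ℝ) : opNorm (A + B) ≤ opNorm A + opNorm B :=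
  norm_add_le A B

theorem opNorm_mul_le (A : Matrix (Fin l) (Fin m) ℝ) (B : Matrix (Fin m) (Fin n) ℝ) :
    opNorm (A * B) ≤ opNorm A * opNorm B :=
  Matrix.l2_opNorm_mul A B

theorem opNorm_diagonal_le (v : Fin n → ℝ) {C : ℝ} (hC : 0 ≤ C) (h : ∀ i, |v i| ≤ C) :
    opNorm (Matrix.diagonal v) ≤ C :=
  (Matrix.l2_opNorm_diagonal v).trans_le ((pi_norm_le_iff_of_nonneg hC).2 h)

end

theorem sum_sq_mulVec_le (A : Matrix (Fin m) (Fin n) ℝ) (x : Fin n → ℝ) :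
    ∑ i, (A.mulVec x) i ^ 2 ≤ opNorm A ^ 2 * ∑ j, x j ^ 2 := by
  have h := (Matrix.toEuclideanLin A).toContinuousLinearMap.le_opNorm (WithLp.toLp 2 x)
  have h2 := pow_le_pow_left₀ (norm_nonneg _) h 2
  rw [mul_pow, EuclideanSpace.real_norm_sq_eq, EuclideanSpace.real_norm_sq_eq] at h2
  exact h2

theorem opNorm_sq_le_of_forall (A : Matrix (Fin m) (Fin n) ℝ) {C : ℝ} (hC : 0 ≤ C)
    (h : ∀ x : Fin n → ℝ, ∑ i, (A.mulVec x) i ^ 2 ≤ C * ∑ j, x j ^ 2) : opNorm A ^ 2 ≤ C := by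
  have h1 : opNorm A ≤ √C := by
    refine ContinuousLinearMap.opNorm_le_bound _ (Real.sqrt_nonneg C) fun x => ?_
    refine abs_le_of_sq_le_sq' ?_ (by positivity) |>.2
    rw [mul_pow, Real.sq_sqrt hC, EuclideanSpace.real_norm_sq_eq, EuclideanSpace.real_norm_sq_eq]
    exact h x
  calc opNorm A ^ 2 ≤ √C ^ 2 := pow_le_pow_left₀ (opNorm_nonneg A) h1 2
    _ = C := Real.sq_sqrt hC

theorem opNorm_sq_le_sum_sq (A : Matrix (Fin m) (Fin n) ℝ) :
    opNorm A ^ 2 ≤ ∑ i, ∑ j, A i j ^ 2 := by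
  refine opNorm_sq_le_of_forall A (by positivity) fun x => ?_
  rw [Finset.sum_mul]
  exact Finset.sum_le_sum fun i _ => Finset.sum_mul_sq_le_sq_mul_sq Finset.univ (A i) x

/-- Each of the `n` columns is the image of a unit vector. Applied to `V`, this is the source of the
factor `d` in `m₂`. -/
theorem sum_sq_le_mul_opNorm_sq (A : Matrix (Fin m) (Fin n) ℝ) :
    ∑ i, ∑ j, A i j ^ 2 ≤ n * opNorm A ^ 2 := by
  rw [Finset.sum_comm]
  have h : ∀ j ∈ (Finset.univ : Finset (Fin n)), ∑ i, A i j ^ 2 ≤ opNorm A ^ 2 := fun j _ => by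
    have h := sum_sq_mulVec_le A (Pi.single j 1)
    simpa [Matrix.mulVec_single_one, Pi.single_apply] using h
  simpa using Finset.sum_le_card_nsmul _ _ _ h

/-- The all-ones vector is fixed. -/
theorem one_le_opNorm_of_row_sum_eq_one [NeZero n] (P : Matrix (Fin n) (Fin n) ℝ)
    (h : ∀ i, ∑ j, P i j = 1) : 1 ≤ opNorm P := by
  have h1 := sum_sq_mulVec_le P fun _ => 1
  have hn : (0 : ℝ) < n := by exact_mod_cast NeZero.pos n
  simp only [Matrix.mulVec, dotProduct, mul_one, h, one_pow, Finset.sum_const, Finset.card_univ,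
    Fintype.card_fin, nsmul_eq_mul] at h1
  have h2 : 1 ≤ opNorm P ^ 2 := by nlinarith
  exact (one_le_sq_iff₀ (opNorm_nonneg P)).1 h2

/-- Scaling the rows of a matrix with nonnegative entries and row sums at most `1`. -/
theorem opNorm_sq_diagonal_mul_le (P : Matrix (Fin m) (Fin n) ℝ) (hP : ∀ i j, 0 ≤ P i j)
    (hrow : ∀ i, ∑ j, P i j ≤ 1) (g : Fin m → ℝ) {C : ℝ} (hC : 0 ≤ C)
    (hcol : ∀ j, ∑ i, g i ^ 2 * P i j ≤ C) :
    opNorm (Matrix.diagonal g * P) ^ 2 ≤ C := by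
  refine opNorm_sq_le_of_forall _ hC fun x => ?_
  have hi : ∀ i, ((Matrix.diagonal g * P).mulVec x) i ^ 2 ≤ ∑ j, g i ^ 2 * P i j * x j ^ 2 := by
    intro i
    -- Splitting `P i j` into two square roots lets Cauchy–Schwarz consume the row sum in one factor
    -- and keep `P i j * x j ^ 2` in the other.
    have e : ((Matrix.diagonal g * P).mulVec x) i = g i * ∑ j, √(P i j) * (√(P i j) * x j) := by
      simp only [Matrix.mulVec, dotProduct, Matrix.diagonal_mul, Finset.mul_sum]
      refine Finset.sum_congr rfl fun j _ => ?_
      nth_rw 1 [← Real.mul_self_sqrt (hP i j)]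
      ring
    have hcs := Finset.sum_mul_sq_le_sq_mul_sq Finset.univ (fun j => √(P i j))
      (fun j => √(P i j) * x j)
    simp only [mul_pow, Real.sq_sqrt (hP i _)] at hcs
    have h2 : (∑ j, √(P i j) * (√(P i j) * x j)) ^ 2 ≤ ∑ j, P i j * x j ^ 2 :=
      hcs.trans (mul_le_of_le_one_left
        (Finset.sum_nonneg fun j _ => mul_nonneg (hP i j) (sq_nonneg _)) (hrow i))
    rw [e, mul_pow]
    refine (mul_le_mul_of_nonneg_left h2 (sq_nonneg _)).trans_eq ?_
    rw [Finset.mul_sum]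
    exact Finset.sum_congr rfl fun j _ => (mul_assoc _ _ _).symm
  calc _ ≤ ∑ i, ∑ j, g i ^ 2 * P i j * x j ^ 2 := Finset.sum_le_sum fun i _ => hi i
    _ = ∑ j, (∑ i, g i ^ 2 * P i j) * x j ^ 2 := by
      rw [Finset.sum_comm]
      simp only [Finset.sum_mul]
    _ ≤ ∑ j, C * x j ^ 2 :=
      Finset.sum_le_sum fun j _ => mul_le_mul_of_nonneg_right (hcol j) (sq_nonneg _)
    _ = C * ∑ j, x j ^ 2 := (Finset.mul_sum _ _ _).symm

/-- Scaling the rows of a substochastic matrix with small columns by small numbers. -/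
theorem opNorm_sq_diagonal_mul_le_sqrt (P : Matrix (Fin m) (Fin n) ℝ) (hP : ∀ i j, 0 ≤ P i j)
    (hrow : ∀ i, ∑ j, P i j ≤ 1) (g : Fin m → ℝ) {B s t : ℝ} (hB : 0 ≤ B)
    (hg : ∀ i, |g i| ≤ B) (hs : ∑ i, g i ^ 2 ≤ s) (hcol : ∀ j, ∑ i, P i j ^ 2 ≤ t) :
    opNorm (Matrix.diagonal g * P) ^ 2 ≤ B * √(s * t) := by
  refine opNorm_sq_diagonal_mul_le P hP hrow g (by positivity) fun j => ?_
  -- Of the two factors `|g i|` in `g i ^ 2`, one is bounded by `B` and the other is paired with the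
  -- column of `P` by Cauchy–Schwarz.
  have hcs := Finset.sum_mul_sq_le_sq_mul_sq Finset.univ (fun i => |g i|) (fun i => P i j)
  simp only [sq_abs] at hcs
  have h1 : ∑ i, |g i| * P i j ≤ √(s * t) := by
    refine Real.le_sqrt_of_sq_le (hcs.trans ?_)
    exact mul_le_mul hs (hcol j) (Finset.sum_nonneg fun i _ => sq_nonneg _)
      ((Finset.sum_nonneg fun i _ => sq_nonneg _).trans hs)
  calc ∑ i, g i ^ 2 * P i j ≤ ∑ i, B * (|g i| * P i j) := by
        refine Finset.sum_le_sum fun i _ => ?_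
        rw [← sq_abs, sq, mul_assoc]
        exact mul_le_mul_of_nonneg_right (hg i) (mul_nonneg (abs_nonneg _) (hP i j))
    _ = B * ∑ i, |g i| * P i j := (Finset.mul_sum _ _ _).symm
    _ ≤ _ := mul_le_mul_of_nonneg_left h1 hB

end OpNorm

/-! ### The softmax matrix and the split of the spectral error. -/

section Softmax

variable {n d : ℕ} (Q K : Matrix (Fin n) (Fin d) ℝ)

theorem attnMatrix_pos (i j : Fin n) : 0 < attnMatrix Q K i j := Real.exp_pos _

theorem attnDiag_eq_sum (i : Fin n) : attnDiag Q K i = ∑ j, attnMatrix Q K i j :=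
  Finset.sum_congr rfl fun j _ => abs_of_pos (attnMatrix_pos Q K i j)

theorem attnDiag_pos (i : Fin n) : 0 < attnDiag Q K i := by
  rw [attnDiag_eq_sum]
  exact Finset.sum_pos (fun j _ => attnMatrix_pos Q K i j) ⟨i, Finset.mem_univ i⟩

theorem softmaxMatrix_apply (i j : Fin n) :
    softmaxMatrix Q K i j = attnMatrix Q K i j / attnDiag Q K i := by
  rw [softmaxMatrix, Matrix.diagonal_mul, inv_mul_eq_div]

theorem softmaxMatrix_nonneg (i j : Fin n) : 0 ≤ softmaxMatrix Q K i j := by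
  rw [softmaxMatrix_apply]
  exact (div_pos (attnMatrix_pos Q K i j) (attnDiag_pos Q K i)).le

theorem softmaxMatrix_row_sum (i : Fin n) : ∑ j, softmaxMatrix Q K i j = 1 := by
  simp only [softmaxMatrix_apply]
  rw [← Finset.sum_div, ← attnDiag_eq_sum, div_self (attnDiag_pos Q K i).ne']

theorem diagonal_inv_mul_attnMatrix (D : Fin n → ℝ) :
    Matrix.diagonal (fun i => (D i)⁻¹) * attnMatrix Q K =
      Matrix.diagonal (fun i => attnDiag Q K i / D i) * softmaxMatrix Q K := by
  ext i j
  rw [Matrix.diagonal_mul, Matrix.diagonal_mul, softmaxMatrix_apply]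
  have := (attnDiag_pos Q K i).ne'
  field_simp

/-- The spectral guarantee follows from a mean square bound on the relative errors of the diagonal
estimates and a bound on the error of the sampled matrix product. -/
theorem spectralGuarantee_of_errors [NeZero n] {m : ℕ} (V : Matrix (Fin n) (Fin d) ℝ)
    {ε w s q : ℝ} (hw : 1 ≤ w) (D : Fin n → ℝ) (S : Sampling n m) (hD : ∀ i, 0 < D i)
    (hDw : ∀ i, attnDiag Q K i ≤ w ^ 2 * D i)
    (hs : ∑ i, (1 - attnDiag Q K i / D i) ^ 2 ≤ s)
    (hcol : ∀ j, ∑ i, softmaxMatrix Q K i j ^ 2 ≤ w / n)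
    (hsε : w ^ 2 * √(s * (w / n)) ≤ (ε / 2) ^ 2)
    (hq : ∑ i, ∑ k, (softmaxMatrix Q K * V -
      softmaxMatrix Q K * S.toMatrix.transpose * (S.toMatrix * V)) i k ^ 2 ≤ q)
    (hqε : w ^ 4 * q ≤ (ε / 2) ^ 2 * opNorm V ^ 2) (hε : 0 < ε) :
    SpectralGuarantee Q K V ε (D, S) := by
  refine ⟨hD, ?_⟩
  set P := softmaxMatrix Q K with hPdef
  have hEpos : ∀ i, 0 ≤ attnDiag Q K i / D i := fun i => (div_pos (attnDiag_pos Q K i) (hD i)).le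
  have hEle : ∀ i, attnDiag Q K i / D i ≤ w ^ 2 := fun i => (div_le_iff₀ (hD i)).2 (hDw i)
  have hw2 : 1 ≤ w ^ 2 := one_le_pow₀ hw
  set E : Fin n → ℝ := fun i => attnDiag Q K i / D i with hE
  set R := P * V - P * S.toMatrix.transpose * (S.toMatrix * V) with hR
  -- The diagonal error multiplies the exact product, and the sampling error `R` is only rescaled by
  -- `E`.
  have hdecomp : P * V - Matrix.diagonal (fun i => (D i)⁻¹) * attnMatrix Q K *
      S.toMatrix.transpose * (S.toMatrix * V) =
      Matrix.diagonal (fun i => 1 - E i) * P * V + Matrix.diagonal E * R := by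
    have h1 : Matrix.diagonal (fun i => 1 - E i) = 1 - Matrix.diagonal E := by
      rw [← Matrix.diagonal_one, Matrix.diagonal_sub]
    rw [diagonal_inv_mul_attnMatrix, h1, hR]
    simp only [Matrix.sub_mul, Matrix.mul_sub, Matrix.one_mul, Matrix.mul_assoc]
    abel
  have hP1 : 1 ≤ opNorm P := one_le_opNorm_of_row_sum_eq_one P (softmaxMatrix_row_sum Q K)
  have hA : opNorm (Matrix.diagonal (fun i => 1 - E i) * P) ≤ ε / 2 := by
    refine (abs_le_of_sq_le_sq' ((opNorm_sq_diagonal_mul_le_sqrt P (softmaxMatrix_nonneg Q K)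
      (fun i => (softmaxMatrix_row_sum Q K i).le) _ (by positivity) (fun i => ?_) hs hcol).trans
      hsε) (by positivity)).2
    -- Since `0 ≤ E i ≤ w ^ 2` and `1 ≤ w ^ 2`, also `|1 - E i| ≤ w ^ 2`.
    rw [abs_le]
    constructor <;> linarith [hEpos i, hEle i]
  have hB : opNorm (Matrix.diagonal E * R) ≤ ε / 2 * opNorm V := by
    have h1 : opNorm (Matrix.diagonal E) ≤ w ^ 2 := opNorm_diagonal_le E (by positivity) fun i => by
      rw [abs_of_nonneg (hEpos i)]
      exact hEle i
    have h2 : w ^ 2 * opNorm R ≤ ε / 2 * opNorm V := by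
      refine (abs_le_of_sq_le_sq' ?_ (mul_nonneg (by positivity) (opNorm_nonneg V))).2
      rw [mul_pow, mul_pow]
      refine le_trans ?_ hqε
      rw [← pow_mul]
      exact mul_le_mul_of_nonneg_left ((opNorm_sq_le_sum_sq R).trans hq) (by positivity)
    exact (opNorm_mul_le _ _).trans ((mul_le_mul_of_nonneg_right h1 (opNorm_nonneg R)).trans h2)
  have hV := opNorm_nonneg V
  calc _ = opNorm (Matrix.diagonal (fun i => 1 - E i) * P * V + Matrix.diagonal E * R) := by
        exact congrArg opNorm hdecomp
    _ ≤ ε / 2 * opNorm V + ε / 2 * opNorm V :=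
        (opNorm_add_le _ _).trans (add_le_add
          ((opNorm_mul_le _ _).trans (mul_le_mul_of_nonneg_right hA hV)) hB)
    _ = ε * 1 * opNorm V := by ring
    _ ≤ ε * opNorm P * opNorm V := by gcongr

end Softmax

/-! ### Accuracy of the diagonal estimates. -/

section ApproxD

theorem mean_uniformOfFintype {n : ℕ} [NeZero n] (f : Fin n → ℝ) :
    (PMF.uniformOfFintype (Fin n)).mean f = (∑ i, f i) / n := by
  simp [PMF.mean, Finset.sum_div, inv_mul_eq_div]

/-- Capping loses something only if `x > y`, and then the loss is below `x ≤ x ^ 2 / y`. This turns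
the bias of the cap into a second moment. -/
theorem sub_min_le_sq_div {x y : ℝ} (hx : 0 ≤ x) (hy : 0 < y) : x - min x y ≤ x ^ 2 / y := by
  rw [le_div_iff₀ hy]
  rcases le_total x y with h | h
  · rw [min_eq_left h]; nlinarith
  · rw [min_eq_right h]; nlinarith

variable {n d : ℕ}

theorem SparseMask.one_sub_toMatrix_mul (M : SparseMask n) (i j : Fin n) (x : ℝ) :
    (1 - M.toMatrix i j) * x = if j ∈ M i then 0 else x := by
  by_cases h : j ∈ M i <;> simp [SparseMask.toMatrix, h]

theorem val_attnEntry (Q K : Matrix (Fin n) (Fin d) ℝ) (i j : Fin n) :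
    (attnEntry Q K i j).val = attnMatrix Q K i j := rfl

theorem val_ifUnmasked (M : SparseMask n) (i j : Fin n) (t : Timed ℝ) :
    (ifUnmasked M i j t).val = if j ∈ M i then 0 else t.val := by
  by_cases h : j ∈ M i <;> simp [ifUnmasked, Timed.mem, h]

theorem attnDiag_eq_masked_add_unmasked (Q K : Matrix (Fin n) (Fin d) ℝ) (M : SparseMask n)
    (i : Fin n) : attnDiag Q K i =
      ∑ j ∈ M i, attnMatrix Q K i j + unmaskedRowSum M.toMatrix (attnMatrix Q K) i := by
  simp only [unmaskedRowSum, SparseMask.one_sub_toMatrix_mul]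
  rw [attnDiag_eq_sum, ← Finset.sum_filter_add_sum_filter_not Finset.univ (· ∈ M i),
    Finset.filter_univ_mem, Finset.sum_filter _ fun j => attnMatrix Q K i j]
  congr 1
  exact Finset.sum_congr rfl fun j _ => by by_cases h : j ∈ M i <;> simp [h]

theorem unmaskedRowSum_nonneg (Q K : Matrix (Fin n) (Fin d) ℝ) (M : SparseMask n) (i : Fin n) :
    0 ≤ unmaskedRowSum M.toMatrix (attnMatrix Q K) i := by
  simp only [unmaskedRowSum, SparseMask.one_sub_toMatrix_mul]
  refine Finset.sum_nonneg fun j _ => ?_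
  split_ifs
  exacts [le_rfl, (attnMatrix_pos Q K i j).le]

theorem masked_sum_nonneg (Q K : Matrix (Fin n) (Fin d) ℝ) (M : SparseMask n) (i : Fin n) :
    0 ≤ ∑ j ∈ M i, attnMatrix Q K i j :=
  Finset.sum_nonneg fun j _ => (attnMatrix_pos Q K i j).le

/-- The estimate of an unmasked row sum from the sampled columns `l` with cap `C`. -/
noncomputable def cappedEstimate (Q K : Matrix (Fin n) (Fin d) ℝ) (M : SparseMask n) {m : ℕ}
    (C : ℝ) (l : Fin m → Fin n) (i : Fin n) : ℝ :=
  (n : ℝ) / m * ∑ j, if l j ∈ M i then 0 else min (attnMatrix Q K i (l j)) C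

/-- The mean square error of the estimate: sampling variance and bias of the cap. -/
theorem mean_sq_cappedEstimate_sub_le [NeZero n] (Q K : Matrix (Fin n) (Fin d) ℝ)
    (M : SparseMask n) {m : ℕ} (hm : 0 < m) {C : ℝ} (hC : 0 < C) (i : Fin n) :
    (iid m (PMF.uniformOfFintype (Fin n))).mean (fun l =>
      (cappedEstimate Q K M C l i - unmaskedRowSum M.toMatrix (attnMatrix Q K) i) ^ 2) ≤
      2 * (n / m + attnDiag Q K i / C) * ∑ j, attnMatrix Q K i j ^ 2 := by
  set A := attnMatrix Q K with hA
  have hApos : ∀ j, 0 < A i j := attnMatrix_pos Q K i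
  have hn : (0 : ℝ) < n := by exact_mod_cast NeZero.pos n
  have hm' : (0 : ℝ) < m := by exact_mod_cast hm
  set f : Fin n → ℝ := fun j => if j ∈ M i then 0 else min (A i j) C with hf
  set u := unmaskedRowSum M.toMatrix A i with hu
  have hu' : u = ∑ j, if j ∈ M i then 0 else A i j := by
    simp only [hu, unmaskedRowSum, SparseMask.one_sub_toMatrix_mul]
  have hf0 : ∀ j, 0 ≤ f j := fun j => by
    simp only [hf]
    split_ifs
    exacts [le_rfl, le_min (hApos j).le hC.le]
  have hfA : ∀ j, f j ≤ A i j := fun j => by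
    simp only [hf]
    split_ifs
    exacts [(hApos j).le, min_le_left _ _]
  set v := ∑ j, f j with hv
  -- Scaling by `n` makes the mean under the uniform law equal to the capped row sum `v`.
  have hvar := PMF.mean_iid_sq_sub_le (p := PMF.uniformOfFintype (Fin n)) hm fun j => n * f j
  simp only [mean_uniformOfFintype, ← Finset.mul_sum, ← hv, mul_div_cancel_left₀ _ hn.ne'] at hvar
  have hvar2 : (∑ j, (n * f j) ^ 2) / n / m ≤ n / m * ∑ j, A i j ^ 2 := by
    have e : (∑ j, (n * f j) ^ 2) / n / m = n / m * ∑ j, f j ^ 2 := by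
      simp only [mul_pow, ← Finset.mul_sum]
      field_simp
    rw [e]
    gcongr with j
    exacts [hf0 j, hfA j]
  have hbias0 : 0 ≤ u - v := by
    rw [hu', hv, ← Finset.sum_sub_distrib]
    refine Finset.sum_nonneg fun j _ => ?_
    simp only [hf]
    split_ifs <;> simp
  have hbias1 : u - v ≤ (∑ j, A i j ^ 2) / C := by
    rw [hu', hv, ← Finset.sum_sub_distrib, Finset.sum_div]
    refine Finset.sum_le_sum fun j _ => ?_
    simp only [hf]
    split_ifs
    · simp only [sub_zero]; positivity
    · exact sub_min_le_sq_div (hApos j).le hC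
  have hbias2 : u - v ≤ attnDiag Q K i := by
    have h1 : 0 ≤ v := Finset.sum_nonneg fun j _ => hf0 j
    have h2 := attnDiag_eq_masked_add_unmasked Q K M i
    have h3 := masked_sum_nonneg Q K M i
    linarith
  -- One factor of the bias is bounded by the whole row sum, the other by the second moment over
  -- `C`.
  have hbias : (u - v) ^ 2 ≤ attnDiag Q K i / C * ∑ j, A i j ^ 2 := by
    calc (u - v) ^ 2 = (u - v) * (u - v) := sq _
      _ ≤ attnDiag Q K i * ((∑ j, A i j ^ 2) / C) :=
        mul_le_mul hbias2 hbias1 hbias0 (attnDiag_pos Q K i).le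
      _ = _ := by ring
  have hpt : ∀ l : Fin m → Fin n, (cappedEstimate Q K M C l i - u) ^ 2 ≤
      2 * ((n * ∑ j, f (l j)) / m - v) ^ 2 + 2 * (u - v) ^ 2 := fun l => by
    have e : cappedEstimate Q K M C l i = (n * ∑ j, f (l j)) / m := by
      rw [cappedEstimate, div_mul_eq_mul_div]
    rw [e]
    nlinarith [sq_nonneg ((n * ∑ j, f (l j)) / m - v + (u - v))]
  refine (PMF.mean_mono _ hpt).trans ?_
  rw [PMF.mean_add, PMF.mean_const, PMF.mean_const_mul]
  linarith

variable (Q K : Matrix (Fin n) (Fin d) ℝ) (M : SparseMask n)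

/-- Estimating the diagonal entries with a good threshold `τ`. -/
theorem mean_sum_sq_relative_error_le [NeZero n] {κ ε c w τ : ℝ} {m : ℕ} (hm : 0 < m)
    (hκ : 0 < κ) (hc : 0 < c) (hw : 1 ≤ w) (hκw : κ ≤ w) (hεw : 1 / w < ε) (hL : 0 < Real.log n)
    (hcol : ∀ j, ∑ i, softmaxMatrix Q K i j ^ 2 ≤ w / n)
    (hτu : ∀ i, τ ≤ κ * unmaskedRowSum M.toMatrix (attnMatrix Q K) i)
    (huτ : ∀ i, unmaskedRowSum M.toMatrix (attnMatrix Q K) i ≤ κ * τ) :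
    ∃ a C : Fin n → ℝ, (∀ i, a i = ∑ j ∈ M i, attnMatrix Q K i j) ∧
      (∀ i, C i = c * (ε ^ 2 * m / (n * Real.log n) * (a i + τ / κ))) ∧
      (∀ x i, attnDiag Q K i ≤ w ^ 2 * (a i + max x (τ / κ))) ∧
      (iid m (PMF.uniformOfFintype (Fin n))).mean (fun l => ∑ i, (1 - attnDiag Q K i /
        (a i + max (cappedEstimate Q K M (C i) l i) (τ / κ))) ^ 2) ≤
      2 * (n / m) * w ^ 9 * (1 + Real.log n / c) := by
  set a : Fin n → ℝ := fun i => ∑ j ∈ M i, attnMatrix Q K i j with ha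
  set C : Fin n → ℝ := fun i => c * (ε ^ 2 * m / (n * Real.log n) * (a i + τ / κ)) with hCdef
  set u : Fin n → ℝ := unmaskedRowSum M.toMatrix (attnMatrix Q K) with hu
  have hn : (0 : ℝ) < n := by exact_mod_cast NeZero.pos n
  have hm' : (0 : ℝ) < m := by exact_mod_cast hm
  have hw0 : 0 < w := by linarith
  have hε : 0 < ε := (by positivity : 0 < 1 / w).trans hεw
  have ha0 : ∀ i, 0 ≤ a i := masked_sum_nonneg Q K M
  have hDpos := attnDiag_pos Q K
  have hD : ∀ i, attnDiag Q K i = a i + u i := attnDiag_eq_masked_add_unmasked Q K M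
  -- The floor alone suffices: `u i ≤ κτ = κ² (τ/κ)`, so this lower bound on the estimate involves
  -- no randomness of the sampled columns.
  have hlow : ∀ i, attnDiag Q K i ≤ w ^ 2 * (a i + τ / κ) := fun i => by
    have h1 : u i ≤ κ ^ 2 * (τ / κ) := (huτ i).trans_eq (by field_simp)
    have hτ0 : 0 ≤ τ / κ := by
      have h0 := (unmaskedRowSum_nonneg Q K M i).trans (huτ i)
      exact div_nonneg (nonneg_of_mul_nonneg_right h0 hκ) hκ.le
    have h2 : κ ^ 2 * (τ / κ) ≤ w ^ 2 * (τ / κ) := by gcongr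
    have h3 : 1 * a i ≤ w ^ 2 * a i := mul_le_mul_of_nonneg_right (one_le_pow₀ hw) (ha0 i)
    rw [hD]
    linarith
  have hlow' : ∀ x i, attnDiag Q K i ≤ w ^ 2 * (a i + max x (τ / κ)) := fun x i =>
    (hlow i).trans (by gcongr; exact le_max_right _ _)
  have hapos : ∀ i, 0 < a i + τ / κ := fun i =>
    pos_of_mul_pos_right ((hDpos i).trans_le (hlow i)) (by positivity)
  refine ⟨a, C, fun i => rfl, fun i => rfl, hlow', ?_⟩
  have hCpos : ∀ i, 0 < C i := fun i =>
    mul_pos hc (mul_pos (by positivity) (hapos i))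
  -- One factor `w ^ 2` pays for `D i ≤ w ^ 2 (a i + τ/κ)`, the other for `1/ε²`; the rest is the
  -- prefactor of `C i`.
  have hDC : ∀ i, attnDiag Q K i / C i ≤ n / m * (w ^ 4 * (Real.log n / c)) := fun i => by
    have hε2 : 1 ≤ w ^ 2 * ε ^ 2 := by
      rw [← mul_pow]
      refine one_le_pow₀ ?_
      rw [div_lt_iff₀ hw0] at hεw
      linarith
    rw [div_le_iff₀ (hCpos i)]
    have e : n / m * (w ^ 4 * (Real.log n / c)) * C i =
        (w ^ 2 * ε ^ 2) * (w ^ 2 * (a i + τ / κ)) := by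
      simp only [hCdef]
      field_simp
    rw [e]
    exact (hlow i).trans (le_mul_of_one_le_left (mul_nonneg (by positivity) (hapos i).le) hε2)
  have hpt : ∀ l : Fin m → Fin n, ∑ i, (1 - attnDiag Q K i /
      (a i + max (cappedEstimate Q K M (C i) l i) (τ / κ))) ^ 2 ≤
      ∑ i, w ^ 4 / attnDiag Q K i ^ 2 * (cappedEstimate Q K M (C i) l i - u i) ^ 2 := fun l => by
    refine Finset.sum_le_sum fun i _ => ?_
    set t := cappedEstimate Q K M (C i) l i with ht
    set D' := a i + max t (τ / κ) with hD'
    have hl := hlow' t i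
    rw [← hD'] at hl
    have hD'pos : 0 < D' := pos_of_mul_pos_right ((hDpos i).trans_le hl) (by positivity)
    -- The true value `u i` already lies above the floor, and `max · (τ / κ)` is a contraction, so
    -- applying the floor to the estimate cannot increase its error.
    have hu2 : max (u i) (τ / κ) = u i := max_eq_left ((div_le_iff₀' hκ).2 (hτu i))
    have hdiff : (D' - attnDiag Q K i) ^ 2 ≤ (t - u i) ^ 2 := by
      rw [sq_le_sq, hD, hD', add_sub_add_left_eq_sub]
      nth_rw 1 [← hu2]
      exact abs_max_sub_max_le_abs _ _ _
    have hDD : attnDiag Q K i ^ 2 ≤ w ^ 4 * D' ^ 2 :=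
      (pow_le_pow_left₀ (hDpos i).le hl 2).trans_eq (by ring)
    have e : (1 - attnDiag Q K i / D') ^ 2 = (D' - attnDiag Q K i) ^ 2 / D' ^ 2 := by
      rw [← div_pow, sub_div, div_self hD'pos.ne']
    rw [e, div_mul_eq_mul_div, div_le_div_iff₀ (pow_pos hD'pos 2) (pow_pos (hDpos i) 2)]
    calc (D' - attnDiag Q K i) ^ 2 * attnDiag Q K i ^ 2 ≤ (t - u i) ^ 2 * (w ^ 4 * D' ^ 2) :=
          mul_le_mul hdiff hDD (sq_nonneg _) (sq_nonneg _)
      _ = _ := by ring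
  refine (PMF.mean_mono _ hpt).trans ?_
  rw [PMF.mean_sum]
  have hL' := hL.le
  have hrow : ∀ i ∈ Finset.univ, (iid m (PMF.uniformOfFintype (Fin n))).mean (fun l =>
      w ^ 4 / attnDiag Q K i ^ 2 * (cappedEstimate Q K M (C i) l i - u i) ^ 2) ≤
      2 * (n / m) * w ^ 8 * (1 + Real.log n / c) * ∑ j, softmaxMatrix Q K i j ^ 2 := fun i _ => by
    rw [PMF.mean_const_mul]
    have h1 := mean_sq_cappedEstimate_sub_le Q K M hm (hCpos i) i
    have h2 : 2 * (n / m + attnDiag Q K i / C i) ≤ 2 * (n / m) * (w ^ 4 * (1 + Real.log n / c)) := by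
      have h3 : (n : ℝ) / m * 1 ≤ n / m * w ^ 4 := by
        gcongr
        exact one_le_pow₀ hw
      have := hDC i
      linarith
    refine (mul_le_mul_of_nonneg_left (h1.trans (mul_le_mul_of_nonneg_right h2
      (Finset.sum_nonneg fun j _ => sq_nonneg _))) (by positivity)).trans_eq ?_
    simp only [softmaxMatrix_apply, div_pow]
    rw [← Finset.sum_div]
    have := (hDpos i).ne'
    field_simp
  refine (Finset.sum_le_sum hrow).trans ?_
  rw [← Finset.mul_sum, Finset.sum_comm]
  -- The `n` column bounds `w / n` add up to `w`, which raises the exponent from `8` to `9`.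
  have hF : ∑ j, ∑ i, softmaxMatrix Q K i j ^ 2 ≤ w := by
    refine (Finset.sum_le_card_nsmul _ _ _ fun j _ => hcol j).trans_eq ?_
    simp only [Finset.card_univ, Fintype.card_fin, nsmul_eq_mul]
    field_simp
  refine (mul_le_mul_of_nonneg_left hF (by positivity)).trans_eq (by ring)

/-- The only property of `T` that matters is that it is nonempty, since the maximum over any
nonempty set of rows is within a factor `κ` of every row sum. All the failure probability is in the
draw of the columns. -/
theorem approxD_prob_ge [NeZero n] {κ ε c w : ℝ} {m : ℕ} (hm : 0 < m)
    (hκ : 0 < κ) (hc : 0 < c) (hw : 1 ≤ w) (hκw : κ ≤ w) (hεw : 1 / w < ε) (hL : 0 < Real.log n)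
    (hcol : ∀ j, ∑ i, softmaxMatrix Q K i j ^ 2 ≤ w / n)
    (hM : CondNumberLE M.toMatrix (attnMatrix Q K) κ) :
    99 / 100 ≤ (approxD Q K M κ ε c m).prob fun D => (∀ i, 0 < D i) ∧
      (∀ i, attnDiag Q K i ≤ w ^ 2 * D i) ∧
      ∑ i, (1 - attnDiag Q K i / D i) ^ 2 ≤
        200 * (n / m) * w ^ 9 * (1 + Real.log n / c) := by
  set G : (Fin n → ℝ) → Prop := fun D => (∀ i, 0 < D i) ∧
      (∀ i, attnDiag Q K i ≤ w ^ 2 * D i) ∧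
      ∑ i, (1 - attnDiag Q K i / D i) ^ 2 ≤
        200 * (n / m) * w ^ 9 * (1 + Real.log n / c) with hG
  rw [← one_mul (99 / 100 : ENNReal), approxD]
  refine Alg.mul_le_prob_bind _ _ (fun T => T.Nonempty) _ ?_ fun T hT => ?_
  · rw [Alg.prob_draw]
    refine ((PMF.toOuterMeasure_apply_eq_one_iff _ _).2 fun T hT => ?_).ge
    rw [uniformSubset, PMF.mem_support_uniformOfFinset_iff, Finset.mem_powersetCard] at hT
    refine Finset.card_pos.1 ?_
    rw [hT.2]
    exact lt_min hm (NeZero.pos n)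
  rw [Alg.prob_run_bind]
  set τ := (Timed.max T fun j =>
    Timed.sum Finset.univ fun k => ifUnmasked M j k (attnEntry Q K j k)).val with hτdef
  have hτ : τ = T.fold max 0 (unmaskedRowSum M.toMatrix (attnMatrix Q K)) := by
    rw [hτdef]
    refine Finset.fold_congr fun j _ => ?_
    change ∑ k, (ifUnmasked M j k (attnEntry Q K j k)).val = _
    refine Finset.sum_congr rfl fun k _ => ?_
    rw [val_ifUnmasked, SparseMask.one_sub_toMatrix_mul, val_attnEntry]
  -- The initial value `0` of the running maximum is harmless because unmasked row sums are
  -- nonnegative.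
  have hτu : ∀ i, τ ≤ κ * unmaskedRowSum M.toMatrix (attnMatrix Q K) i := fun i => by
    rw [hτ, Finset.fold_max_le]
    exact ⟨mul_nonneg hκ.le (unmaskedRowSum_nonneg Q K M i), fun j _ => hM j i⟩
  have huτ : ∀ i, unmaskedRowSum M.toMatrix (attnMatrix Q K) i ≤ κ * τ := fun i => by
    obtain ⟨j, hj⟩ := hT
    refine (hM i j).trans (mul_le_mul_of_nonneg_left ?_ hκ.le)
    rw [hτ, Finset.le_fold_max]
    exact Or.inr ⟨j, hj, le_rfl⟩
  obtain ⟨a, C, ha, hC, hlow, hmean⟩ :=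
    mean_sum_sq_relative_error_le Q K M hm hκ hc hw hκw hεw hL hcol hτu huτ
  rw [← mul_one (99 / 100 : ENNReal)]
  refine Alg.mul_le_prob_bind _ _ (fun l => ∑ i, (1 - attnDiag Q K i /
        (a i + max (cappedEstimate Q K M (C i) l i) (τ / κ))) ^ 2 ≤
        200 * (n / m) * w ^ 9 * (1 + Real.log n / c)) _ ?_ fun l hl => ?_
  · rw [Alg.prob_draw]
    refine PMF.le_toOuterMeasure_of_mean_le _ _ (fun l => by positivity) _ ?_
    linarith
  · refine (Alg.prob_run _ _ ?_).ge
    have hval : ∀ i, ((Timed.array fun i => do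
        let a ← Timed.sum (M i) fun k => attnEntry Q K i k
        let C ← Timed.op 10 (c * (ε ^ 2 * m / (n * Real.log n) * (a + τ / κ)))
        let u ← Timed.sum Finset.univ fun j : Fin m => ifUnmasked M i (l j) (do
          let e ← attnEntry Q K i (l j)
          Timed.op 1 (min e C))
        let t ← Timed.op 2 ((n : ℝ) / m * u)
        Timed.op 3 (a + Max.max t (τ / κ))).val : Fin n → ℝ) i =
        a i + max (cappedEstimate Q K M (C i) l i) (τ / κ) := fun i => by
      rw [hC, ha]
      simp only [Timed.array, Timed.val_bind, Timed.val_op, Timed.sum, val_ifUnmasked,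
        val_attnEntry, cappedEstimate]
    simp only [hG, hval]
    refine ⟨fun i => ?_, fun i => hlow _ i, hl⟩
    exact pos_of_mul_pos_right ((attnDiag_pos Q K i).trans_le (hlow _ i)) (by positivity)

end ApproxD

/-! ### Approximate matrix multiplication by row norm sampling. -/

section RowNormSampling

theorem toReal_categorical_apply {n : ℕ} [NeZero n] {w : Fin n → ℝ} (hw : ∀ i, 0 ≤ w i)
    {i : Fin n} (hi : w i ≠ 0) : (categorical w i).toReal = w i / ∑ j, w j := by
  have hsum : ∑' j, ENNReal.ofReal (w j) = ENNReal.ofReal (∑ j, w j) := by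
    rw [tsum_fintype, ENNReal.ofReal_sum_of_nonneg fun j _ => hw j]
  have hpos : 0 < w i := lt_of_le_of_ne (hw i) hi.symm
  have hspos : 0 < ∑ j, w j := Finset.sum_pos' (fun j _ => hw j) ⟨i, Finset.mem_univ i, hpos⟩
  have h0 : ∑' j, ENNReal.ofReal (w j) ≠ 0 := by
    rw [hsum]
    exact (ENNReal.ofReal_pos.2 hspos).ne'
  rw [categorical, dif_neg h0, PMF.normalize_apply, hsum, ENNReal.toReal_mul, ENNReal.toReal_inv,
    ENNReal.toReal_ofReal hpos.le, ENNReal.toReal_ofReal hspos.le, div_eq_mul_inv]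

variable {n d m : ℕ}

theorem Sampling.mul_transpose_mul_mul_apply (S : Sampling n m) (X : Matrix (Fin n) (Fin n) ℝ)
    (V : Matrix (Fin n) (Fin d) ℝ) (i : Fin n) (k : Fin d) :
    (X * S.toMatrix.transpose * (S.toMatrix * V)) i k =
      ∑ p, S.scale p ^ 2 * (X i (S.idx p) * V (S.idx p) k) := by
  rw [Matrix.mul_apply]
  refine Finset.sum_congr rfl fun p _ => ?_
  simp only [Matrix.mul_apply, Matrix.transpose_apply, Sampling.toMatrix, mul_ite, mul_zero,
    ite_mul, zero_mul, Finset.sum_ite_eq', Finset.mem_univ, if_true]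
  ring

/-- Approximate matrix multiplication with row norm sampling. -/
theorem rowNormSampling_prob_ge [NeZero n] (X : Matrix (Fin n) (Fin n) ℝ)
    (V : Matrix (Fin n) (Fin d) ℝ) (hm : 0 < m) :
    99 / 100 ≤ (rowNormSampling V m).prob fun S =>
      ∑ i, ∑ k, (X * V - X * S.toMatrix.transpose * (S.toMatrix * V)) i k ^ 2 ≤
        100 * ((∑ i, ∑ k, V i k ^ 2) * (∑ i, ∑ j, X i j ^ 2) / m) := by
  have hm' : (0 : ℝ) < m := by exact_mod_cast hm
  set w : Fin n → ℝ := fun i => ∑ k, V i k * V i k with hwdef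
  set F : ℝ := ∑ i, w i with hF
  have hw0 : ∀ i, 0 ≤ w i := fun i => Finset.sum_nonneg fun k _ => mul_self_nonneg _
  have hF0 : 0 ≤ F := Finset.sum_nonneg fun i _ => hw0 i
  have hFV : ∑ i, ∑ k, V i k ^ 2 = F := by simp only [hF, hwdef, sq]
  have hV : ∀ i, w i = 0 → ∀ k, V i k = 0 := fun i hi k =>
    mul_self_eq_zero.1
      ((Finset.sum_eq_zero_iff_of_nonneg fun k _ => mul_self_nonneg _).1 hi k (Finset.mem_univ k))
  have hFpos : ∀ i, w i ≠ 0 → F ≠ 0 := fun i hi => (Finset.sum_pos' (fun j _ => hw0 j)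
    ⟨i, Finset.mem_univ i, lt_of_le_of_ne (hw0 i) hi.symm⟩).ne'
  -- The importance-weighted unbiased estimator of one entry of `X * V`. Where `w j = 0` the row of
  -- `V` vanishes, so `g` is `0` there; this also covers `V = 0` with its uniform law.
  set g : Fin n → Fin d → Fin n → ℝ := fun i k j => F / w j * (X i j * V j k) with hg
  have hmean : ∀ i k, (categorical w).mean (g i k) = (X * V) i k := fun i k => by
    rw [Matrix.mul_apply]
    refine Finset.sum_congr rfl fun j _ => ?_
    by_cases hj : w j = 0
    · simp [hg, hV j hj]
    · have := hFpos j hj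
      rw [toReal_categorical_apply hw0 hj, ← hF]
      simp only [hg]
      field_simp
  have hmean2 : ∀ i k, (categorical w).mean (fun j => g i k j ^ 2) =
      ∑ j, F / w j * (X i j ^ 2 * (V j k * V j k)) := fun i k => by
    refine Finset.sum_congr rfl fun j _ => ?_
    by_cases hj : w j = 0
    · simp [hg, hV j hj]
    · have := hFpos j hj
      rw [toReal_categorical_apply hw0 hj, ← hF]
      simp only [hg]
      field_simp
  -- Summing over `k` turns the squared entries of row `j` of `V` into `w j`, which cancels the
  -- importance weight.
  have htotal : ∑ i, ∑ k, (categorical w).mean (fun j => g i k j ^ 2) ≤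
      F * ∑ i, ∑ j, X i j ^ 2 := by
    simp only [hmean2, Finset.mul_sum]
    refine Finset.sum_le_sum fun i _ => ?_
    rw [Finset.sum_comm]
    refine Finset.sum_le_sum fun j _ => ?_
    rw [← Finset.mul_sum, ← Finset.mul_sum]
    change F / w j * (X i j ^ 2 * w j) ≤ _
    by_cases hj : w j = 0
    · simp only [hj, mul_zero]
      positivity
    · exact le_of_eq (by field_simp)
  have herr : (iid m (categorical w)).mean (fun l => ∑ i, ∑ k,
      ((∑ p, g i k (l p)) / m - (X * V) i k) ^ 2) ≤ F * (∑ i, ∑ j, X i j ^ 2) / m := by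
    simp only [PMF.mean_sum]
    calc _ ≤ ∑ i, ∑ k, (categorical w).mean (fun j => g i k j ^ 2) / m :=
          Finset.sum_le_sum fun i _ => Finset.sum_le_sum fun k _ => by
            rw [← hmean i k]
            exact PMF.mean_iid_sq_sub_le hm _
      _ = (∑ i, ∑ k, (categorical w).mean fun j => g i k j ^ 2) / m := by
          simp only [Finset.sum_div]
      _ ≤ _ := div_le_div_of_nonneg_right htotal hm'.le
  rw [hFV, ← mul_one (99 / 100 : ENNReal), rowNormSampling, Alg.prob_run_bind, Alg.prob_run_bind]
  refine Alg.mul_le_prob_bind _ _ (fun l => ∑ i, ∑ k,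
      ((∑ p, g i k (l p)) / m - (X * V) i k) ^ 2 ≤ 100 * (F * (∑ i, ∑ j, X i j ^ 2) / m)) _ ?_
      fun l hl => ?_
  · rw [Alg.prob_draw]
    exact PMF.le_toOuterMeasure_of_mean_le _ _ (fun l => by positivity) _
      (mul_le_mul_of_nonneg_left herr (by norm_num))
  · rw [Alg.prob_run_bind]
    refine (Alg.prob_pure _ _ ?_).ge
    refine le_trans (le_of_eq ?_) hl
    refine Finset.sum_congr rfl fun i _ => Finset.sum_congr rfl fun k _ => ?_
    rw [Matrix.sub_apply, Sampling.mul_transpose_mul_mul_apply, sub_sq_comm]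
    congr 2
    rw [Finset.sum_div]
    refine Finset.sum_congr rfl fun p _ => ?_
    change (√F / (√m * √(w (l p)))) ^ 2 * (X i (l p) * V (l p) k) = g i k (l p) / m
    rw [div_pow, mul_pow, Real.sq_sqrt hF0, Real.sq_sqrt hm'.le, Real.sq_sqrt (hw0 _)]
    simp only [hg]
    ring

end RowNormSampling

/-! ### Sparsity and cost of the sortLSH mask. -/

section Sparsity

theorem nnz_toMatrix_le {n b : ℕ} (M : SparseMask n) (hM : ∀ i, (M i).card ≤ b) :
    nnz M.toMatrix ≤ n * b := by
  classical
  have h : {p : Fin n × Fin n | M.toMatrix p.1 p.2 ≠ 0} =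
      (Finset.univ.filter fun p : Fin n × Fin n => p.2 ∈ M p.1 : Finset _) := by
    ext p
    simp [SparseMask.toMatrix]
  rw [nnz, h, Set.ncard_coe_finset, Finset.card_filter, Fintype.sum_prod_type]
  simpa using Finset.sum_le_card_nsmul Finset.univ (fun i => (M i).card) b fun i _ => hM i

variable {n d r : ℕ} (H : HammingSortedLSH d r) (s : H.Seed) (Q K : Matrix (Fin n) (Fin d) ℝ)

/-- A block is an interval of `b` positions, and `PK` sends distinct keys to distinct positions. -/
theorem card_sortLSH_val_le {b : ℕ} (hb : 1 ≤ b) (i : Fin n) :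
    ((sortLSH H s Q K b).val i).card ≤ b := by
  set PQ := (Timed.sort (Timed.array fun i => H.hash s (Q i)).val).val.symm
  set PK := (Timed.sort (Timed.array fun i => H.hash s (K i)).val).val.symm
  change (Finset.univ.filter fun j => (PQ i : ℕ) / b = (PK j : ℕ) / b).card ≤ b
  set q := (PQ i : ℕ) / b
  have h : (Finset.univ.filter fun j => q = (PK j : ℕ) / b).card ≤
      (Finset.Ico (q * b) (q * b + b)).card := by
    refine Finset.card_le_card_of_injOn (fun j => (PK j : ℕ)) (fun j hj => ?_)
      fun j _ k _ hjk => PK.injective (Fin.ext hjk)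
    have hj' : q = (PK j : ℕ) / b := by simpa using hj
    simp only [Finset.coe_Ico, Set.mem_Ico]
    rw [hj', mul_comm]
    exact ⟨Nat.mul_div_le _ _, Nat.lt_mul_div_succ _ hb⟩
  simpa using h

theorem steps_sortLSH_le {b h : ℕ} (hh : ∀ x, (H.hash s x).steps ≤ h) :
    (sortLSH H s Q K b).steps ≤
      H.drawSteps + 2 * (n * (h + 1)) + 4 * n * (Nat.clog 2 n + 1) + 2 * n + n * (2 * b + 3) := by
  have h1 := Timed.steps_array_le (fun i => H.hash s (Q i)) h fun i => hh _
  have h2 := Timed.steps_array_le (fun i => H.hash s (K i)) h fun i => hh _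
  set PQ := (Timed.sort (Timed.array fun i => H.hash s (Q i)).val).val.symm
  set PK := (Timed.sort (Timed.array fun i => H.hash s (K i)).val).val.symm
  have h3 := Timed.steps_array_le (fun i : Fin n => Timed.op (2 * b + 2)
    (Finset.univ.filter fun j : Fin n => (PQ i : ℕ) / b = (PK j : ℕ) / b)) (2 * b + 2) fun i => le_rfl
  change H.drawSteps + ((Timed.array fun i => H.hash s (Q i)).steps +
    ((Timed.array fun i => H.hash s (K i)).steps + (2 * n * (Nat.clog 2 n + 1) +
    (2 * n * (Nat.clog 2 n + 1) + (n + (n + (Timed.array fun i : Fin n => Timed.op (2 * b + 2)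
    (Finset.univ.filter fun j : Fin n => (PQ i : ℕ) / b = (PK j : ℕ) / b)).steps)))))) ≤ _
  linarith

end Sparsity

/-! ### Running time of the whole algorithm. -/

section Runtime

variable {n d : ℕ}

theorem steps_attnEntry (Q K : Matrix (Fin n) (Fin d) ℝ) (i j : Fin n) :
    (attnEntry Q K i j).steps = 2 * d + 1 := by
  simp [attnEntry, Timed.steps_dot]

theorem steps_ifUnmasked_le (M : SparseMask n) (i j : Fin n) {t : Timed ℝ} {b k : ℕ}
    (hb : (M i).card ≤ b) (hk : 1 ≤ k) (ht : t.steps ≤ k) :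
    (ifUnmasked M i j t).steps ≤ b + 1 + k := by
  by_cases h : j ∈ M i <;> simp [ifUnmasked, Timed.mem, h] <;> omega

theorem Alg.RunsWithin.mono {α : Type} {p : Alg α} {S T : ℝ} (h : p.RunsWithin S) (hST : S ≤ T) :
    p.RunsWithin T :=
  fun o ho => (h o ho).trans hST

theorem approxD_runsWithin [NeZero n] (Q K : Matrix (Fin n) (Fin d) ℝ) (M : SparseMask n)
    (κ ε c : ℝ) (m : ℕ) {b : ℕ} (hM : ∀ i, (M i).card ≤ b) :
    (approxD Q K M κ ε c m).RunsWithin ((n : ℝ) + ((m * (n * (b + 2 * d + 3) + 1) : ℕ) + (m +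
      (n * (b * (2 * d + 2) + m * (b + 2 * d + 4) + 16) : ℕ)))) := by
  rw [approxD]
  refine Alg.runsWithin_bind (Alg.runsWithin_draw _ _) fun o ho => ?_
  have hT := (Alg.mem_support_draw ho).1
  rw [uniformSubset, PMF.mem_support_uniformOfFinset_iff, Finset.mem_powersetCard] at hT
  refine Alg.runsWithin_bind (Alg.runsWithin_run ?_) fun τ _ =>
    Alg.runsWithin_bind (Alg.runsWithin_draw _ _) fun l _ => Alg.runsWithin_run ?_
  · refine Nat.cast_le.2 ((Timed.steps_max_le _ _ (n * (b + 2 * d + 3)) fun j _ => ?_).trans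
      (Nat.mul_le_mul_right _ (hT.2.trans_le (min_le_left _ _))))
    refine (Timed.steps_sum_le _ _ (b + 1 + (2 * d + 1)) fun k _ =>
      steps_ifUnmasked_le M j k (hM j) (by omega) (steps_attnEntry Q K j k).le).trans (le_of_eq ?_)
    rw [Finset.card_univ, Fintype.card_fin]
    ring
  · refine Nat.cast_le.2 ((Timed.steps_array_le _
      (b * (2 * d + 2) + m * (b + 2 * d + 4) + 15) fun i => ?_).trans (le_of_eq (by ring)))
    have h1 := (Timed.steps_sum_le (M i) (fun k => attnEntry Q K i k) _ fun k _ =>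
      (steps_attnEntry Q K i k).le).trans (Nat.mul_le_mul_right _ (hM i))
    simp only [Timed.steps_bind, Timed.steps_op, Timed.val_op]
    refine le_trans (add_le_add h1 (add_le_add_right (add_le_add_left
      (Timed.steps_sum_le _ _ (b + 1 + (2 * d + 2)) fun j _ =>
        steps_ifUnmasked_le M i _ (hM i) (by omega) ?_) _) _)) (le_of_eq ?_)
    · simp [steps_attnEntry]
    · rw [Finset.card_univ, Fintype.card_fin]
      ring

theorem rowNormSampling_runsWithin [NeZero n] (V : Matrix (Fin n) (Fin d) ℝ) (m : ℕ) :
    (rowNormSampling V m).RunsWithin (((n * (2 * d + 1) : ℕ) : ℝ) + ((n : ℕ) +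
      ((m * (2 * n) : ℕ) + ((m * 6 : ℕ) + 0)))) := by
  rw [rowNormSampling]
  refine Alg.runsWithin_bind (Alg.runsWithin_run ?_) fun w _ =>
    Alg.runsWithin_bind (Alg.runsWithin_run ?_) fun F _ =>
    Alg.runsWithin_bind (Alg.runsWithin_draw _ _) fun l _ =>
    Alg.runsWithin_bind (Alg.runsWithin_run ?_) fun sc _ => Alg.runsWithin_pure _
  · exact Nat.cast_le.2 (Timed.steps_array_le _ _ fun i => (Timed.steps_dot _ _).le)
  · refine Nat.cast_le.2 ((Timed.steps_sum_le _ _ 0 fun i _ => le_rfl).trans (le_of_eq ?_))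
    simp
  · exact Nat.cast_le.2 (Timed.steps_array_le _ 5 fun i => le_rfl)

/-- With `x = d * w * w₁`, each term of the step count is at most a constant times `n * x`, except
for sorting, which brings in `1 + Real.log n`. The constant `100` is a generous total. -/
theorem hyperAttentionLSH_runsWithin {r : ℕ} [NeZero n] (H : HammingSortedLSH d r) (s : H.Seed)
    (Q K V : Matrix (Fin n) (Fin d) ℝ) {b : ℕ} (hb : 1 ≤ b) (κ ε c : ℝ) (m₁ m₂ : ℕ)
    (hd : 1 ≤ d) {w w₁ : ℝ} (hw : 1 ≤ w) (hw₁ : 1 ≤ w₁) (hbw : (b : ℝ) ≤ w)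
    (hdraw : (H.drawSteps : ℝ) ≤ d * w) (hhash : ∀ x, ((H.hash s x).steps : ℝ) ≤ d * w)
    (hm₁ : (m₁ : ℝ) ≤ w₁) (hm₂ : (m₂ : ℝ) ≤ d * w₁) :
    (hyperAttentionLSH H s Q K V b κ ε c m₁ m₂).RunsWithin
      (100 * (d * w * w₁) * n * (1 + Real.log n)) := by
  have hd' : (1 : ℝ) ≤ d := by exact_mod_cast hd
  have hn : (1 : ℝ) ≤ n := by exact_mod_cast NeZero.pos n
  have hL : 0 ≤ Real.log n := Real.log_nonneg hn
  have hM := card_sortLSH_val_le H s Q K hb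
  have h1 : (hyperAttentionLSH H s Q K V b κ ε c m₁ m₂).RunsWithin _ :=
    Alg.runsWithin_bind (Alg.runsWithin_run (Nat.cast_le.2 (steps_sortLSH_le H s Q K (b := b)
      (h := ⌊(d : ℝ) * w⌋₊) fun x => Nat.le_floor (hhash x)))) fun o ho => by
        rw [Alg.mem_support_run ho]
        exact Alg.runsWithin_bind (approxD_runsWithin Q K _ κ ε c m₁ hM) fun D _ =>
          Alg.runsWithin_bind (rowNormSampling_runsWithin V m₂) fun S _ => Alg.runsWithin_pure _
  refine h1.mono ?_
  have hfl : (⌊(d : ℝ) * w⌋₊ : ℝ) ≤ d * w := Nat.floor_le (by positivity)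
  -- Uses `log 2 ≥ 1/2` to pass from binary to natural logarithms.
  have hclog : (Nat.clog 2 n : ℝ) + 1 ≤ 2 * (1 + Real.log n) := by
    have h2 : Nat.clog 2 n ≤ Nat.log 2 n + 1 := by
      refine Nat.clog_le_of_le_pow (Nat.lt_pow_succ_log_self (by norm_num) n).le
    have h3 : (Nat.log 2 n : ℝ) * Real.log 2 ≤ Real.log n := by
      rw [← Real.log_pow]
      refine Real.log_le_log (by positivity) ?_
      exact_mod_cast Nat.pow_log_le_self 2 (NeZero.ne n)
    have h4 : (Nat.log 2 n : ℝ) * (1 / 2) ≤ Nat.log 2 n * Real.log 2 := by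
      gcongr
      linarith [Real.log_two_gt_d9]
    have h5 : (Nat.clog 2 n : ℝ) ≤ Nat.log 2 n + 1 := by exact_mod_cast h2
    linarith
  set x : ℝ := d * w * w₁ with hx
  have hdw : (d : ℝ) * w ≤ x := le_mul_of_one_le_right (by positivity) hw₁
  have hd1 : (d : ℝ) ≤ x := (le_mul_of_one_le_right (by positivity) hw).trans hdw
  have hx1 : 1 ≤ x := hd'.trans hd1
  have hww : w * w₁ ≤ x := by
    rw [hx, mul_assoc]
    exact le_mul_of_one_le_left (by positivity) hd'
  have hbx : (b : ℝ) ≤ x := hbw.trans ((le_mul_of_one_le_right (by positivity) hw₁).trans hww)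
  have hdw₁ : d * w₁ ≤ x := by
    rw [hx]
    gcongr
    exact le_mul_of_one_le_right (by positivity) hw
  have hmx : (m₁ : ℝ) ≤ x :=
    hm₁.trans ((le_mul_of_one_le_left (by positivity) hd').trans hdw₁)
  have hmb : (m₁ : ℝ) * b ≤ x := by
    refine le_trans ?_ hww
    rw [mul_comm]
    gcongr
  have hmd : (m₁ : ℝ) * d ≤ x := by
    refine le_trans ?_ hdw₁
    rw [mul_comm]
    gcongr
  have hbd : (b : ℝ) * d ≤ x := by
    refine le_trans ?_ hdw
    rw [mul_comm]
    gcongr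
  have hm₂x : (m₂ : ℝ) ≤ x := hm₂.trans hdw₁
  have hn0 : (0 : ℝ) ≤ n := by positivity
  have e1 := mul_le_mul_of_nonneg_left (hfl.trans hdw) hn0
  have e2 := mul_le_mul_of_nonneg_left hclog hn0
  have e3 := mul_le_mul_of_nonneg_left hx1 hn0
  have e4 := mul_le_mul_of_nonneg_left hbx hn0
  have e5 := mul_le_mul_of_nonneg_left hmx hn0
  have e6 := mul_le_mul_of_nonneg_left hmb hn0
  have e7 := mul_le_mul_of_nonneg_left hmd hn0
  have e8 := mul_le_mul_of_nonneg_left hbd hn0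
  have e9 := mul_le_mul_of_nonneg_left hm₂x hn0
  have e10 := mul_le_mul_of_nonneg_left hd1 hn0
  have e11 : x ≤ n * x := le_mul_of_one_le_left (by positivity) hn
  have e12 : n * (1 + Real.log n) ≤ n * x * (1 + Real.log n) := by
    gcongr
    exact le_mul_of_one_le_right hn0 hx1
  have e13 : n * x ≤ n * x * (1 + Real.log n) :=
    le_mul_of_one_le_right (by positivity) (by linarith)
  push_cast
  linarith

end Runtime

/-! ### Sample sizes, exponents and the final assembly. -/

section Main

/-- The sample sizes solve the two error budgets with `ε` replaced by its lower bound `1 / w`. The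
diagonal budget needs `200 (1 + log n / c) w¹⁰ / m₁ ≤ (1 / (4 w⁴))²`, the product budget `100 d w⁵ /
m₂ ≤ 1 / (4 w²)`. -/
theorem hyperAttentionLSH_prob_ge {n d r : ℕ} [NeZero n] (H : HammingSortedLSH d r) (s : H.Seed)
    (Q K V : Matrix (Fin n) (Fin d) ℝ) (b : ℕ) {κ ε c w : ℝ} {m₁ m₂ : ℕ} (hd : 1 ≤ d)
    (hκ : 0 < κ) (hc : 0 < c) (hw : 1 ≤ w) (hκw : κ ≤ w) (hεw : 1 / w < ε) (hL : 0 < Real.log n)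
    (hcol : ∀ j, ∑ i, softmaxMatrix Q K i j ^ 2 ≤ w / n)
    (hM : CondNumberLE (lshMask H s Q K b) (attnMatrix Q K) κ)
    (hm₁ : 3200 * (1 + Real.log n / c) * w ^ 18 ≤ m₁) (hm₂ : d * (400 * w ^ 7) ≤ m₂) :
    98 / 100 ≤ (hyperAttentionLSH H s Q K V b κ ε c m₁ m₂).prob (SpectralGuarantee Q K V ε) := by
  have hn : (0 : ℝ) < n := by exact_mod_cast NeZero.pos n
  have hd' : (0 : ℝ) < d := by exact_mod_cast hd
  have hw0 : 0 < w := by linarith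
  have hε : 0 < ε := (by positivity : 0 < 1 / w).trans hεw
  have hΛ : 0 < 1 + Real.log n / c := by positivity
  have hm₁' : (0 : ℝ) < m₁ := lt_of_lt_of_le (by positivity) hm₁
  have hm₂' : (0 : ℝ) < m₂ := lt_of_lt_of_le (by positivity) hm₂
  have hε2 : 1 / (4 * w ^ 2) ≤ (ε / 2) ^ 2 := by
    calc 1 / (4 * w ^ 2) = (1 / w / 2) ^ 2 := by field_simp; norm_num
      _ ≤ (ε / 2) ^ 2 := by gcongr
  have h98 : (98 / 100 : ENNReal) ≤ 99 / 100 * (99 / 100 * 1) := by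
    rw [← ENNReal.toReal_le_toReal (ENNReal.div_ne_top (by norm_num) (by norm_num))
      (ENNReal.mul_ne_top (ENNReal.div_ne_top (by norm_num) (by norm_num))
        (ENNReal.mul_ne_top (ENNReal.div_ne_top (by norm_num) (by norm_num)) (by norm_num)))]
    simp only [ENNReal.toReal_mul, ENNReal.toReal_div, ENNReal.toReal_ofNat, ENNReal.toReal_one]
    norm_num
  rw [hyperAttentionLSH, Alg.prob_run_bind, hyperAttention]
  refine h98.trans (Alg.mul_le_prob_bind _ _ _ _
    (approxD_prob_ge Q K _ (by exact_mod_cast hm₁') hκ hc hw hκw hεw hL hcol hM) fun D hD => ?_)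
  refine Alg.mul_le_prob_bind _ _ _ _
    (rowNormSampling_prob_ge (softmaxMatrix Q K) V (by exact_mod_cast hm₂')) fun S hS => ?_
  refine (Alg.prob_pure _ _ ?_).ge
  obtain ⟨hD0, hDw, hDs⟩ := hD
  refine spectralGuarantee_of_errors Q K V hw D S hD0 hDw hDs hcol ?_ hS ?_ hε
  · have h1 : √(200 * (n / m₁) * w ^ 9 * (1 + Real.log n / c) * (w / n)) ≤ 1 / (4 * w ^ 4) := by
      refine Real.sqrt_le_iff.2 ⟨by positivity, ?_⟩
      have e : 200 * (n / m₁) * w ^ 9 * (1 + Real.log n / c) * (w / n) =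
          200 * w ^ 10 * (1 + Real.log n / c) / m₁ := by
        field_simp
      rw [e, div_pow, one_pow, div_le_div_iff₀ hm₁' (by positivity)]
      linarith
    refine le_trans (mul_le_mul_of_nonneg_left h1 (by positivity)) (le_trans (le_of_eq ?_) hε2)
    field_simp
  · have hF : ∑ i, ∑ j, softmaxMatrix Q K i j ^ 2 ≤ w := by
      rw [Finset.sum_comm]
      refine (Finset.sum_le_card_nsmul _ _ _ fun j _ => hcol j).trans_eq ?_
      simp only [Finset.card_univ, Fintype.card_fin, nsmul_eq_mul]
      field_simp
    have hV := sum_sq_le_mul_opNorm_sq V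
    have hV0 := opNorm_nonneg V
    calc _ ≤ w ^ 4 * (100 * (d * opNorm V ^ 2 * w / m₂)) := by gcongr
      _ = 100 * d * w ^ 5 / m₂ * opNorm V ^ 2 := by ring
      _ ≤ 1 / (4 * w ^ 2) * opNorm V ^ 2 := by
        refine mul_le_mul_of_nonneg_right ?_ (sq_nonneg _)
        rw [div_le_div_iff₀ hm₂' (by positivity)]
        linarith
      _ ≤ _ := by gcongr

/-- A factor `y` equals `n ^ (log y / log n)`; for `y` affine in `log n` this exponent tends to `0`,
so such factors can be hidden in `n^{o(1)}`. -/
theorem tendsto_log_affine_log_div_log {a b : ℝ} (ha : 0 < a) (hb : 0 < b) :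
    Tendsto (fun n : ℕ => Real.log (a * (1 + Real.log n / b)) / Real.log n) atTop (𝓝 0) := by
  have hlog : Tendsto (fun n : ℕ => Real.log n) atTop atTop :=
    Real.tendsto_log_atTop.comp tendsto_natCast_atTop_atTop
  have hlin : Tendsto (fun x : ℝ => a * (1 + x / b)) atTop atTop :=
    (tendsto_atTop_add_const_left _ _ (tendsto_id.atTop_div_const hb)).const_mul_atTop ha
  have hO : (fun x : ℝ => a * (1 + x / b)) =O[atTop] fun x => x := by
    refine Asymptotics.IsBigO.const_mul_left ?_ a
    refine ((Asymptotics.isLittleO_const_id_atTop (1 : ℝ)).isBigO).add ?_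
    simp only [div_eq_inv_mul]
    exact Asymptotics.isBigO_const_mul_self _ _ _
  exact ((Real.isLittleO_log_id_atTop.comp_tendsto hlin).trans_isBigO hO).tendsto_div_nhds_zero.comp
    hlog

theorem rpow_log_div_log {x y : ℝ} (hx : 0 < Real.log x) (hx0 : 0 < x) (hy : 0 < y) :
    x ^ (Real.log y / Real.log x) = y := by
  rw [Real.rpow_def_of_pos hx0, mul_div_cancel₀ _ hx.ne', Real.exp_log hy]

end Main

theorem mainTheorem3 (δ : ℕ → ℝ) (hδ : Tendsto δ atTop (𝓝 0)) (c : ℝ) (hc : 0 < c) :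
    ∃ δ₀ : ℕ → ℝ, Tendsto δ₀ atTop (𝓝 0) ∧
    ∀ δ₁ : ℕ → ℝ, Tendsto δ₁ atTop (𝓝 0) →
    ∃ δ₂ : ℕ → ℝ, Tendsto δ₂ atTop (𝓝 0) ∧
    ∃ N : ℕ, ∀ n : ℕ, N ≤ n → ∀ [NeZero n],
    ∀ (d r b : ℕ) (H : HammingSortedLSH d r) (Q K V : Matrix (Fin n) (Fin d) ℝ) (κ ε : ℝ),
    1 ≤ d →
    -- `r = log₂ n` hash bits (rounded either way) and block size `b = n^{o(1)}`
    (r = Nat.log 2 n ∨ r = Nat.clog 2 n) →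
    1 ≤ b → (b : ℝ) ≤ (n : ℝ) ^ δ n →
    -- the hash function is drawn, and evaluated at one point, in time `d n^{o(1)}`
    (H.drawSteps : ℝ) ≤ d * (n : ℝ) ^ δ n →
    (∀ s x, ((H.hash s x).steps : ℝ) ≤ d * (n : ℝ) ^ δ n) →
    -- `ε > 1 / n^{o(1)}` and `κ = n^{o(1)}`
    1 / (n : ℝ) ^ δ n < ε →
    0 < κ → κ ≤ (n : ℝ) ^ δ n →
    -- the squared column norms of `D⁻¹ A`
    (∀ j, ∑ i, softmaxMatrix Q K i j ^ 2 ≤ (n : ℝ) ^ δ n / n) →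
    -- few query-key pairs have a small angle
    (Set.ncard {p : Fin n × Fin n |
        vecAngle (Q p.1) (K p.2) ≤ Real.pi / 2 * (1 - δ n)} : ℝ) ≤ (n : ℝ) ^ (1 + δ n) →
    -- sparsity of the mask
    1 - 1 / (n : ℝ) ^ δ n ≤
        H.law.real {s | (nnz (lshMask H s Q K b) : ℝ) ≤ (n : ℝ) ^ (1 + δ₂ n)} ∧
    ∀ m₁ m₂ : ℕ, (n : ℝ) ^ δ₀ n ≤ m₁ → d * (n : ℝ) ^ δ₀ n ≤ m₂ →
      -- spectral guarantee, given any hash function whose mask meets the condition on `κ`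
      (∀ s, CondNumberLE (lshMask H s Q K b) (attnMatrix Q K) κ →
        98 / 100 ≤ (hyperAttentionLSH H s Q K V b κ ε c m₁ m₂).prob
          (SpectralGuarantee Q K V ε)) ∧
      -- spectral guarantee over all the randomness, including that of the hash function
      ((∀ᵐ s ∂H.law, CondNumberLE (lshMask H s Q K b) (attnMatrix Q K) κ) →
        98 / 100 ≤ ∫⁻ s, (hyperAttentionLSH H s Q K V b κ ε c m₁ m₂).prob
          (SpectralGuarantee Q K V ε) ∂H.law) ∧
      -- overall running time
      ((m₁ : ℝ) ≤ (n : ℝ) ^ δ₁ n → (m₂ : ℝ) ≤ d * (n : ℝ) ^ δ₁ n →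
        ∀ s, (hyperAttentionLSH H s Q K V b κ ε c m₁ m₂).RunsWithin
          (d * (n : ℝ) ^ (1 + δ₂ n))) := by
  -- The exponents are chosen so that `n ^ δ₀ n` equals the required `m₁` and `n ^ (1 + δ₂ n)`
  -- equals the step bound without its factor `d`. The absolute value of `δ₁ n` makes `w₁ ≥ 1`, and
  -- `n ≥ 3` makes `log n` positive.
  refine ⟨fun n => δ n * (18 : ℕ) + Real.log (3200 * (1 + Real.log n / c)) / Real.log n, ?_,
    fun δ₁ hδ₁ => ⟨fun n => δ n + |δ₁ n| + Real.log (100 * (1 + Real.log n / 1)) / Real.log n,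
      ?_, 3, fun n hn3 _ => ?_⟩⟩
  · simpa using (hδ.mul_const ((18 : ℕ) : ℝ)).add
      (tendsto_log_affine_log_div_log (by norm_num : (0 : ℝ) < 3200) hc)
  · simpa using (hδ.add hδ₁.abs).add
      (tendsto_log_affine_log_div_log (by norm_num : (0 : ℝ) < 100) one_pos)
  intro d r b H Q K V κ ε hd _ hb hbw hdraw hhash hεw hκ hκw hcol _
  have hn1 : (1 : ℝ) < n := by exact_mod_cast (by omega : 1 < n)
  have hn0 : (0 : ℝ) < n := by linarith
  have hL : 0 < Real.log n := Real.log_pos hn1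
  have hd' : (1 : ℝ) ≤ d := by exact_mod_cast hd
  -- The sign of `δ n` is not prescribed; the bound follows from `1 ≤ b ≤ n ^ δ n`.
  have hw : 1 ≤ (n : ℝ) ^ δ n := le_trans (by exact_mod_cast hb) hbw
  have hw₁ : 1 ≤ (n : ℝ) ^ |δ₁ n| := Real.one_le_rpow hn1.le (abs_nonneg _)
  have hδ₀ : (n : ℝ) ^ (δ n * (18 : ℕ) + Real.log (3200 * (1 + Real.log n / c)) / Real.log n) =
      3200 * (1 + Real.log n / c) * ((n : ℝ) ^ δ n) ^ 18 := by
    rw [Real.rpow_add hn0, rpow_log_div_log hL hn0 (by positivity), Real.rpow_mul_natCast hn0.le,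
      mul_comm]
  have hδ₂ : (n : ℝ) ^ (1 + (δ n + |δ₁ n| + Real.log (100 * (1 + Real.log n / 1)) / Real.log n)) =
      100 * ((n : ℝ) ^ δ n * (n : ℝ) ^ |δ₁ n|) * n * (1 + Real.log n) := by
    rw [Real.rpow_add hn0, Real.rpow_add hn0, Real.rpow_add hn0, Real.rpow_one,
      rpow_log_div_log hL hn0 (by positivity), div_one]
    ring
  simp only [hδ₀, hδ₂]
  set w := (n : ℝ) ^ δ n
  set w₁ := (n : ℝ) ^ |δ₁ n|
  have hprob : ∀ m₁ m₂ : ℕ, 3200 * (1 + Real.log n / c) * w ^ 18 ≤ m₁ →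
      d * (3200 * (1 + Real.log n / c) * w ^ 18) ≤ m₂ →
      ∀ s, CondNumberLE (lshMask H s Q K b) (attnMatrix Q K) κ →
        98 / 100 ≤ (hyperAttentionLSH H s Q K V b κ ε c m₁ m₂).prob
          (SpectralGuarantee Q K V ε) := fun m₁ m₂ hm₁ hm₂ s hM => by
    refine hyperAttentionLSH_prob_ge H s Q K V b hd hκ hc hw hκw hεw hL hcol hM hm₁
      (le_trans ?_ hm₂)
    have h1 : 400 * w ^ 7 ≤ 3200 * 1 * w ^ 18 := by
      have := pow_le_pow_right₀ hw (by norm_num : 7 ≤ 18)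
      have : 0 ≤ w ^ 7 := by positivity
      linarith
    have h2 : 3200 * 1 * w ^ 18 ≤ 3200 * (1 + Real.log n / c) * w ^ 18 := by
      gcongr
      exact le_add_of_nonneg_right (by positivity)
    exact mul_le_mul_of_nonneg_left (h1.trans h2) (by linarith)
  refine ⟨?_, fun m₁ m₂ hm₁ hm₂ => ⟨hprob m₁ m₂ hm₁ hm₂, fun hae => ?_, fun hm₁' hm₂' s => ?_⟩⟩
  · have huniv : {s | (nnz (lshMask H s Q K b) : ℝ) ≤
        100 * (w * w₁) * n * (1 + Real.log n)} = Set.univ := by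
      refine Set.eq_univ_of_forall fun s => ?_
      have h1 : (nnz (lshMask H s Q K b) : ℝ) ≤ n * b := by
        exact_mod_cast nnz_toMatrix_le _ (card_sortLSH_val_le H s Q K hb)
      refine h1.trans ?_
      calc (n : ℝ) * b ≤ n * w := by gcongr
        _ = 1 * (w * 1) * n * 1 := by ring
        _ ≤ 100 * (w * w₁) * n * (1 + Real.log n) := by gcongr <;> linarith
    rw [huniv, probReal_univ]
    have : 0 ≤ 1 / w := by positivity
    linarith
  · calc (98 / 100 : ENNReal) = ∫⁻ _, 98 / 100 ∂H.law := by simp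
      _ ≤ _ := lintegral_mono_ae (hae.mono (hprob m₁ m₂ hm₁ hm₂))
  · have hle : (n : ℝ) ^ δ₁ n ≤ w₁ := Real.rpow_le_rpow_of_exponent_le hn1.le (le_abs_self _)
    refine (hyperAttentionLSH_runsWithin H s Q K V hb κ ε c m₁ m₂ hd hw hw₁ hbw hdraw (hhash s)
      (hm₁'.trans hle) (hm₂'.trans ?_)).mono (le_of_eq (by ring))
    gcongr
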